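/- A partial computable function $U(p,x)$ of two binary strings (a program $p$ and an input $x$) with binary strings as values is called prefix-free if, for every $x$, the set of $p$ for which $U(p,x)$ is defined does not contain a string together with a proper prefix of it. It is called prefix-stable if, whenever $U(p,x)$ is defined, $U(p',x)$ is defined and equal to $U(p,x)$ for every extension $p'$ of $p$. Let $K_U(y\mid x)=\min\{|p| : U(p,x)=y\}$, $D_U(x,y)=\min\{|p| : U(p,x)=y \text{ and } U(p,y)=x\}$ and $D_{U,U'}(x,y)=\min\{|p| : U(p,x)=y \text{ and } U'(p,y)=x\}$ (the value is $+\infty$ if there is no such $p$). The conditional prefix complexity is $\mathrm{K}(y\mid x)=K_U(y\mid x)$ for a prefix-free $U$ for which $K_U$ is minimal, up to an additive constant, among prefix-free functions, and $E(x,y)=\max\{\mathrm K(x\mid y),\mathrm K(y\mid x)\}$. The prefix-free (respectively prefix-stable) information distance is $D_U$ for a prefix-free (respectively prefix-stable) $U$ for which $D_U$ is minimal, up to an additive constant, in this class. The bipartite prefix-free (respectively bipartite prefix-stable) information distance is $D_{U,U'}$ for a pair $U,U'$ of prefix-free (respectively prefix-stable) functions for which $D_{U,U'}$ is minimal, up to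 an additive constant, among such pairs. **Theorem.** There is a constant $c>0$ such that, for every choice of the optimal functions in the definitions above, there is an $n_0$ such that for every $n\ge n_0$ there exist strings $x,y$ of length $n$ for which $E(x,y)$ is finite and each of the four prefix information distances (prefix-free, prefix-stable, bipartite prefix-free, bipartite prefix-stable) between $x$ and $y$ is at least $E(x,y)+c\log_2\log_2 n$. -/

import Mathlib

open scoped ENNReal

/-- Finite binary strings. -/
abbrev BitString : Type := List Bool

/-- Partial functions `U(p, x)` of two strings (the program `p` and the input `x`) with string
values; `y ∈ U p x` means that `U(p, x)` is defined and equal to `y`. Computability is imposed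
separately. -/
abbrev Machine : Type := BitString → BitString →. BitString

/-- For each input `x`, the set of programs `p` with `U(p, x)` defined contains no string together
with a proper prefix of it. -/
def IsPrefixFree (U : Machine) : Prop :=
  ∀ x p q : BitString, p <+: q → (U p x).Dom → (U q x).Dom → p = q

/-- If `U(p, x)` is defined, then `U(q, x)` is defined and has the same value for every
extension `q` of `p`. -/
def IsPrefixStable (U : Machine) : Prop :=
  ∀ x p q y : BitString, p <+: q → y ∈ U p x → y ∈ U q x

/-- Computable partial prefix-free functions. -/
def IsPrefixFreeMachine (U : Machine) : Prop :=
  Partrec₂ U ∧ IsPrefixFree U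

/-- Computable partial prefix-stable functions. -/
def IsPrefixStableMachine (U : Machine) : Prop :=
  Partrec₂ U ∧ IsPrefixStable U

/-- `K_U(y | x) = min {|p| : U(p, x) = y}`, and `⊤` if there is no such `p`. -/
noncomputable def condComplexity (U : Machine) (y x : BitString) : ℕ∞ :=
  ⨅ (p : BitString) (_ : y ∈ U p x), (p.length : ℕ∞)

/-- The bipartite distance `D_{U,U'}(x, y) = min {|p| : U(p, x) = y and U'(p, y) = x}`, and `⊤` if
there is no such `p`. -/
noncomputable def bipartiteInfoDist (U U' : Machine) (x y : BitString) : ℕ∞ :=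
  ⨅ (p : BitString) (_ : y ∈ U p x ∧ x ∈ U' p y), (p.length : ℕ∞)

/-- The distance `D_U(x, y) = min {|p| : U(p, x) = y and U(p, y) = x}`, and `⊤` if there is no
such `p`. -/
noncomputable def infoDist (U : Machine) (x y : BitString) : ℕ∞ :=
  ⨅ (p : BitString) (_ : y ∈ U p x ∧ x ∈ U p y), (p.length : ℕ∞)

/-- `U` is a prefix-free machine that makes `K_U` minimal, up to an additive constant, among all
prefix-free machines; then `K_U(y | x)` is the conditional prefix complexity. -/
def IsOptimalPrefixComplexityMachine (U : Machine) : Prop :=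
  IsPrefixFreeMachine U ∧
    ∀ V : Machine, IsPrefixFreeMachine V →
      ∃ C : ℕ, ∀ x y : BitString, condComplexity U y x ≤ condComplexity V y x + C

/-- `U` belongs to the class `P` and makes `D_U` minimal, up to an additive constant, among all
machines of this class. -/
def IsOptimalInfoDistMachine (P : Machine → Prop) (U : Machine) : Prop :=
  P U ∧
    ∀ V : Machine, P V →
      ∃ C : ℕ, ∀ x y : BitString, infoDist U x y ≤ infoDist V x y + C

/-- `U` and `U'` belong to the class `P` and make `D_{U,U'}` minimal, up to an additive constant,
among all pairs of machines of this class. -/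
def IsOptimalBipartiteInfoDistPair (P : Machine → Prop) (U U' : Machine) : Prop :=
  P U ∧ P U' ∧
    ∀ V V' : Machine, P V → P V' →
      ∃ C : ℕ, ∀ x y : BitString, bipartiteInfoDist U U' x y ≤ bipartiteInfoDist V V' x y + C

/-- `E(x, y) = max {K(x | y), K(y | x)}`, where `K` is the complexity given by the machine `U`. -/
noncomputable def maxCondComplexity (U : Machine) (x y : BitString) : ℕ∞ :=
  max (condComplexity U x y) (condComplexity U y x)

/-- `a` exceeds `b` by at least `r`, i.e. `b + r ≤ a` (for `r < 0` this only says `b ≤ a`). -/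
def ExceedsBy (a b : ℕ∞) (r : ℝ) : Prop :=
  (b : ℝ≥0∞) + ENNReal.ofReal r ≤ (a : ℝ≥0∞)

/-! The lower bound is a game against a fixed pair of prefix-stable machines. Requests are edges
between strings `false :: u` and `true :: v`. The opponent serves an edge of level `i` by a cell: a
program of length `scale d i + d` leading from each end to the other. By prefix-stability,
comparable cells at a common end serve the same edge. The aim is an edge that has programs of length
`scale d i` in each direction separately, but never gets a cell.

The names in play are cut into stars with `2 ^ scale d i` leaves. A centre spends its whole program
space on one star and then leaves play; a leaf spends one program per round, coding the level and
the round. If a cell that is new even after truncation to the next, coarser scale serves many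
leaves, the game goes on at these leaves, and their common list of used cells grows. Otherwise, by
pigeonhole, some star is served only inside coarse cells already hit
(`exists_star_of_pick_eq_none`). Its cells are distinct because they share a centre, and disjoint
from the old ones because each shares a leaf with them. Hence at the coarser scale the fraction of
program space hit at the remaining leaves is at least `(i + 1) / 2 ^ d`
(`Invariant.succ_mul_le_hits`). So the level never exceeds `2 ^ d`, the number of rounds is bounded,
and some request stays unserved (`exists_edge_without_reply`).

The strategy is computable and its programs form a prefix-free machine (`table_unique`), so both
conditional complexities of the unserved edge are at most `scale d i + C`, while its distance is at
least `scale d i + d`. There are enough names for `d` about half of `log log n` (`enough_names`).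
The bipartite prefix-stable distance is, up to a constant, the smallest of the four, because
prefix-free machines extend to prefix-stable ones and `D_U` is `D_{U,U}`. -/

namespace InfoDistGame

/-! ### Bit strings of a given length -/

/-- The list of all bit strings of length `k`. -/
def bitStrings : ℕ → List BitString
  | 0 => [[]]
  | k + 1 => (bitStrings k).map (List.cons false) ++ (bitStrings k).map (List.cons true)

theorem mem_bitStrings {k : ℕ} {w : BitString} : w ∈ bitStrings k ↔ w.length = k := by
  induction k generalizing w with
  | zero => simp [bitStrings]
  | succ k ih =>
    cases w with
    | nil => simp [bitStrings]
    | cons b w => cases b <;> simp [bitStrings, ih]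

theorem length_bitStrings (k : ℕ) : (bitStrings k).length = 2 ^ k := by
  induction k with
  | zero => simp [bitStrings]
  | succ k ih => simp [bitStrings, ih, pow_succ, mul_two]

theorem nodup_bitStrings (k : ℕ) : (bitStrings k).Nodup := by
  induction k with
  | zero => simp [bitStrings]
  | succ k ih =>
    refine List.Nodup.append (ih.map fun _ _ h => (List.cons.inj h).2)
      (ih.map fun _ _ h => (List.cons.inj h).2) ?_
    intro w h₁ h₂
    simp only [List.mem_map] at h₁ h₂
    obtain ⟨_, _, rfl⟩ := h₁
    obtain ⟨_, _, h⟩ := h₂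
    simp at h

/-- The `r`-th bit string of length `k`, for `r < 2 ^ k`. -/
def binaryCode (k r : ℕ) : BitString := (bitStrings k).getD r []

theorem binaryCode_eq {k r : ℕ} (h : r < 2 ^ k) :
    binaryCode k r = (bitStrings k)[r]'(by rwa [length_bitStrings]) := by
  rw [binaryCode, List.getD_eq_getElem]

theorem length_binaryCode {k r : ℕ} (h : r < 2 ^ k) : (binaryCode k r).length = k := by
  rw [binaryCode_eq h]
  exact mem_bitStrings.1 (List.getElem_mem _)

theorem binaryCode_inj {k r s : ℕ} (hr : r < 2 ^ k) (hs : s < 2 ^ k)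
    (h : binaryCode k r = binaryCode k s) : r = s := by
  rw [binaryCode_eq hr, binaryCode_eq hs] at h
  exact (nodup_bitStrings k).getElem_inj_iff.1 h

/-! ### The strategy -/

/-- A state of the game: the level, the number of successful rounds at this level, the names of
the leaves still in play, and the cells that the opponent has used at all these leaves. -/
abbrev State : Type := ℕ × ℕ × List BitString × List BitString

/-- An edge: the index of its leaf in the star, the name of the centre and the name of the leaf. -/
abbrev Edge : Type := ℕ × BitString × BitString

/-- The edges of level `i` have weight `2 ^ (-scale d i)`. -/
def scale (d i : ℕ) : ℕ := (2 ^ d + 1 - i) * (2 * d + 2)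

/-- The edges requested in a state: the names in play are cut into blocks of length
`2 ^ scale d i + 1`, and the first name of a block is connected to the other ones. -/
def edges (d : ℕ) (σ : State) : List Edge :=
  (List.range σ.2.2.1.length).filterMap fun q =>
    if q % (2 ^ scale d σ.1 + 1) = 0 then none
    else some (q % (2 ^ scale d σ.1 + 1) - 1,
      σ.2.2.1.getD (q - q % (2 ^ scale d σ.1 + 1)) [], σ.2.2.1.getD q [])

/-- The cell given to an edge by the opponent before time `s`, where `ans s p u v` means that the
cell `p` was given to the edge between `u` and `v` before time `s`. -/
def reply (ans : ℕ → BitString → BitString → BitString → Bool) (d s i : ℕ) (e : Edge) :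
    Option BitString :=
  ((bitStrings (scale d i + d)).filter fun p => ans s p (false :: e.2.1) (true :: e.2.2)).head?

/-- The leaves whose edge was given the cell `c`. -/
def survivors (ans : ℕ → BitString → BitString → BitString → Bool) (d s : ℕ) (σ : State)
    (c : BitString) : List BitString :=
  ((edges d σ).filter fun e => decide (reply ans d s σ.1 e = some c)).map fun e => e.2.2

/-- The loss factor for the number of names in one round. -/
def lossFactor (d : ℕ) : ℕ := 2 ^ (2 * scale d 0 + d + 3)

/-- A cell that meets no old cell at the scale of the next level, and is used at many leaves. -/
def pick (ans : ℕ → BitString → BitString → BitString → Bool) (d s : ℕ) (σ : State) :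
    Option BitString :=
  ((bitStrings (scale d σ.1 + d)).filter fun c =>
    (σ.2.2.2.filter fun b =>
        decide (c.take (scale d (σ.1 + 1) + d) = b.take (scale d (σ.1 + 1) + d))).isEmpty &&
      decide (σ.2.2.1.length ≤ lossFactor d * (survivors ans d s σ c).length)).head?

/-- The state after a round in which all edges were given cells. -/
def advance (ans : ℕ → BitString → BitString → BitString → Bool) (d s : ℕ) (σ : State) : State :=
  (pick ans d s σ).casesOn (σ.1 + 1, 0, (edges d σ).map (fun e => e.2.2), σ.2.2.2)
    fun c => (σ.1, σ.2.1 + 1, survivors ans d s σ c, c :: σ.2.2.2)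

/-- One time step: the round ends as soon as all its edges were given cells. -/
def step (ans : ℕ → BitString → BitString → BitString → Bool) (d s : ℕ) (σ : State) : State :=
  if σ.1 ≤ 2 ^ d ∧ ((edges d σ).filter fun e => (reply ans d s σ.1 e).isNone).isEmpty = true then
    advance ans d s σ
  else σ

/-- The state at time `s` of the game whose names are the strings of length `m`. -/
def run (ans : ℕ → BitString → BitString → BitString → Bool) (d m s : ℕ) : State :=
  Nat.rec (0, 0, bitStrings m, []) (fun s σ => step ans d s σ) s

/-- The program that leads from the centre of an edge to its leaf. -/
def centreProgram (d : ℕ) (σ : State) (e : Edge) : BitString :=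
  binaryCode (scale d σ.1) e.1

/-- The program that leads from a leaf to the centre. -/
def leafProgram (d : ℕ) (σ : State) : BitString :=
  binaryCode (d + 1) σ.1 ++ binaryCode (scale d (σ.1 + 1) + d + 1) σ.2.1

/-- The triples input, program, output that are defined in a state. -/
def table (d : ℕ) (σ : State) : List (BitString × BitString × BitString) :=
  if σ.1 ≤ 2 ^ d then
    (edges d σ).map (fun e => (false :: e.2.1, centreProgram d σ e, true :: e.2.2)) ++
      (edges d σ).map (fun e => (true :: e.2.2, leafProgram d σ, false :: e.2.1))
  else []

/-- The output for the program `p` and the input `x` that is defined in a state. -/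
def output (d : ℕ) (σ : State) (p x : BitString) : Option BitString :=
  (((table d σ).filter fun z => decide (z.1 = x ∧ z.2.1 = p)).head?).map fun z => z.2.2

/-- The parameter `d` for strings of length `n`. -/
def depth (n : ℕ) : ℕ := (Nat.log 2 (Nat.log 2 n) - 4) / 2

/-- The machine that simulates the game and gives short programs for all requested edges. -/
def machine (ans : ℕ → BitString → BitString → BitString → Bool) : Machine := fun p x =>
  Nat.rfindOpt fun s =>
    if 2 ^ 16 ≤ x.length then
      output (depth x.length) (run ans (depth x.length) (x.length - 1) s) p x
    else none

/-! ### Computability of the strategy -/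

section Primrec

open Primrec

variable {α β : Type*} [Primcodable α] [Primcodable β]

theorem primrec_pow {f g : α → ℕ} (hf : Primrec f) (hg : Primrec g) :
    Primrec fun a => f a ^ g a :=
  (Primrec₂.unpaired'.1 Nat.Primrec.pow).comp hf hg

theorem primrec_filter {f : α → List β} {p : α → β → Bool} (hf : Primrec f) (hp : Primrec₂ p) :
    Primrec fun a => (f a).filter (p a) := by
  refine (Primrec.listFilterMap hf (g := fun a b => bif p a b then some b else none)
    (Primrec.cond hp (option_some.comp snd) (const none)).to₂).of_eq fun a => ?_
  rw [← List.filterMap_eq_filter]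
  congr 1
  funext b
  cases h : p a b <;> simp [Option.guard, h]

theorem primrec_isEmpty {f : α → List β} (hf : Primrec f) : Primrec fun a => (f a).isEmpty :=
  (Primrec.list_casesOn hf (const true) (const false).to₂).of_eq fun a => by cases f a <;> rfl

theorem primrec_log {f : α → ℕ} (hf : Primrec f) : Primrec fun a => Nat.log 2 (f a) := by
  have h : Primrec (Nat.log 2) := by
    -- The logarithm is a bounded search for the greatest `k ≤ n` with `2 ^ k ≤ n`.
    have h₂ : PrimrecRel fun n k : ℕ => 2 ^ k ≤ n :=
      nat_le.comp (primrec_pow (const 2) snd) fst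
    refine (nat_findGreatest (f := id) Primrec.id h₂).of_eq fun n => ?_
    rcases Nat.eq_zero_or_pos n with rfl | hn
    · simp
    · refine (Nat.findGreatest_eq_iff).2 ⟨Nat.log_le_self 2 n, fun _ => ?_, fun k hk _ => ?_⟩
      · exact Nat.pow_log_le_self 2 hn.ne'
      · exact not_le.2 (Nat.lt_pow_of_log_lt one_lt_two hk)
  exact h.comp hf

theorem primrec_depth {f : α → ℕ} (hf : Primrec f) : Primrec fun a => depth (f a) :=
  nat_div.comp (nat_sub.comp (primrec_log (primrec_log hf)) (const 4)) (const 2)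

theorem primrec_bitStrings {f : α → ℕ} (hf : Primrec f) : Primrec fun a => bitStrings (f a) := by
  have h : Primrec bitStrings := by
    refine (nat_rec₁ [[]] (f := fun (_ : ℕ) (l : List BitString) =>
      l.map (List.cons false) ++ l.map (List.cons true)) ?_).of_eq fun n => ?_
    · exact list_append.comp
        (list_map snd (list_cons.comp (const false) snd).to₂)
        (list_map snd (list_cons.comp (const true) snd).to₂)
    · induction n with
      | zero => rfl
      | succ n ih => simp only [bitStrings, ← ih]
  exact h.comp hf

theorem primrec_binaryCode {f g : α → ℕ} (hf : Primrec f) (hg : Primrec g) :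
    Primrec fun a => binaryCode (f a) (g a) :=
  (list_getD _).comp (primrec_bitStrings hf) hg

theorem primrec_scale {f g : α → ℕ} (hf : Primrec f) (hg : Primrec g) :
    Primrec fun a => scale (f a) (g a) :=
  nat_mul.comp
    (nat_sub.comp (nat_add.comp (primrec_pow (const 2) hf) (const 1)) hg)
    (nat_add.comp (nat_mul.comp (const 2) hf) (const 2))

theorem primrec_edges {d : α → ℕ} {σ : α → State} (hd : Primrec d) (hσ : Primrec σ) :
    Primrec fun a => edges (d a) (σ a) := by
  have hA : Primrec fun a => (σ a).2.2.1 := fst.comp (snd.comp (snd.comp hσ))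
  have hM : Primrec fun a => 2 ^ scale (d a) (σ a).1 + 1 :=
    nat_add.comp (primrec_pow (const 2) (primrec_scale hd (fst.comp hσ))) (const 1)
  have hr : Primrec fun z : α × ℕ => z.2 % (2 ^ scale (d z.1) (σ z.1).1 + 1) :=
    nat_mod.comp snd (hM.comp fst)
  refine Primrec.listFilterMap (list_range.comp (list_length.comp hA)) ?_
  refine Primrec.ite (Primrec.eq.comp hr (const 0)) (const none) (option_some.comp ?_)
  exact (nat_sub.comp hr (const 1)).pair
    (((list_getD _).comp (hA.comp fst) (nat_sub.comp snd hr)).pair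
      ((list_getD _).comp (hA.comp fst) snd))

variable {ans : ℕ → BitString → BitString → BitString → Bool}

theorem primrec_reply
    (hans : Primrec fun z : ℕ × BitString × BitString × BitString =>
      ans z.1 z.2.1 z.2.2.1 z.2.2.2)
    {d s i : α → ℕ} {e : α → Edge} (hd : Primrec d) (hs : Primrec s) (hi : Primrec i)
    (he : Primrec e) : Primrec fun a => reply ans (d a) (s a) (i a) (e a) := by
  refine list_head?.comp (primrec_filter
    (primrec_bitStrings (nat_add.comp (primrec_scale hd hi) hd)) ?_)
  exact hans.comp ((hs.comp fst).pair (snd.pair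
    ((list_cons.comp (const false) (fst.comp (snd.comp (he.comp fst)))).pair
      (list_cons.comp (const true) (snd.comp (snd.comp (he.comp fst)))))))

theorem primrec_survivors
    (hans : Primrec fun z : ℕ × BitString × BitString × BitString =>
      ans z.1 z.2.1 z.2.2.1 z.2.2.2)
    {d s : α → ℕ} {σ : α → State} {c : α → BitString} (hd : Primrec d) (hs : Primrec s)
    (hσ : Primrec σ) (hc : Primrec c) :
    Primrec fun a => survivors ans (d a) (s a) (σ a) (c a) := by
  refine list_map (primrec_filter (primrec_edges hd hσ) ?_) (snd.comp (snd.comp snd)).to₂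
  exact (Primrec.eq.comp (primrec_reply hans (hd.comp fst) (hs.comp fst) (fst.comp (hσ.comp fst))
    snd) (option_some.comp (hc.comp fst))).decide

theorem primrec_pick
    (hans : Primrec fun z : ℕ × BitString × BitString × BitString =>
      ans z.1 z.2.1 z.2.2.1 z.2.2.2)
    {d s : α → ℕ} {σ : α → State} (hd : Primrec d) (hs : Primrec s) (hσ : Primrec σ) :
    Primrec fun a => pick ans (d a) (s a) (σ a) := by
  have hi : Primrec fun a => (σ a).1 := fst.comp hσ
  have hk : Primrec fun a => scale (d a) ((σ a).1 + 1) + d a :=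
    nat_add.comp (primrec_scale hd (nat_add.comp hi (const 1))) hd
  refine list_head?.comp (primrec_filter
    (primrec_bitStrings (nat_add.comp (primrec_scale hd hi) hd)) ?_)
  refine Primrec.and.comp (primrec_isEmpty (primrec_filter
    (snd.comp (snd.comp (snd.comp (hσ.comp fst)))) ?_)) ?_
  · exact (Primrec.eq.comp
      (list_take.comp (hk.comp (fst.comp fst)) (snd.comp fst))
      (list_take.comp (hk.comp (fst.comp fst)) snd)).decide
  · have hQ : Primrec fun a => lossFactor (d a) :=
      primrec_pow (const 2) (nat_add.comp (nat_add.comp (nat_mul.comp (const 2)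
        (primrec_scale hd (const 0))) hd) (const 3))
    exact (nat_le.comp (list_length.comp (fst.comp (snd.comp (snd.comp (hσ.comp fst)))))
      (nat_mul.comp (hQ.comp fst) (list_length.comp
        (primrec_survivors hans (hd.comp fst) (hs.comp fst) (hσ.comp fst) snd)))).decide

theorem primrec_advance
    (hans : Primrec fun z : ℕ × BitString × BitString × BitString =>
      ans z.1 z.2.1 z.2.2.1 z.2.2.2)
    {d s : α → ℕ} {σ : α → State} (hd : Primrec d) (hs : Primrec s) (hσ : Primrec σ) :
    Primrec fun a => advance ans (d a) (s a) (σ a) := by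
  refine option_casesOn (primrec_pick hans hd hs hσ) ?_ ?_
  · exact (nat_add.comp (fst.comp hσ) (const 1)).pair ((const 0).pair
      ((list_map (primrec_edges hd hσ) (snd.comp (snd.comp snd)).to₂).pair
        (snd.comp (snd.comp (snd.comp hσ)))))
  · have hσ' := hσ.comp (fst (α := α) (β := BitString))
    exact (fst.comp hσ').pair ((nat_add.comp (fst.comp (snd.comp hσ')) (const 1)).pair
      ((primrec_survivors hans (hd.comp fst) (hs.comp fst) hσ' snd).pair
        (list_cons.comp snd (snd.comp (snd.comp (snd.comp hσ'))))))

theorem primrec_step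
    (hans : Primrec fun z : ℕ × BitString × BitString × BitString =>
      ans z.1 z.2.1 z.2.2.1 z.2.2.2)
    {d s : α → ℕ} {σ : α → State} (hd : Primrec d) (hs : Primrec s) (hσ : Primrec σ) :
    Primrec fun a => step ans (d a) (s a) (σ a) := by
  refine Primrec.ite (PrimrecPred.and (nat_le.comp (fst.comp hσ) (primrec_pow (const 2) hd))
    (Primrec.eq.comp (primrec_isEmpty (primrec_filter (primrec_edges hd hσ) ?_)) (const true)))
    (primrec_advance hans hd hs hσ) hσ
  have hr := primrec_reply hans (hd.comp (fst (α := α) (β := Edge))) (hs.comp fst)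
    (fst.comp (hσ.comp fst)) snd
  exact (option_casesOn hr (const true) (const false).to₂).of_eq fun a => by
    dsimp only
    cases reply ans (d a.1) (s a.1) (σ a.1).1 a.2 <;> rfl

theorem primrec_run
    (hans : Primrec fun z : ℕ × BitString × BitString × BitString =>
      ans z.1 z.2.1 z.2.2.1 z.2.2.2)
    {d m s : α → ℕ} (hd : Primrec d) (hm : Primrec m) (hs : Primrec s) :
    Primrec fun a => run ans (d a) (m a) (s a) :=
  nat_rec' hs ((const 0).pair ((const 0).pair ((primrec_bitStrings hm).pair (const []))))
    (primrec_step hans (hd.comp fst) (fst.comp snd) (snd.comp snd)).to₂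

theorem primrec_output {d : α → ℕ} {σ : α → State} {p x : α → BitString} (hd : Primrec d)
    (hσ : Primrec σ) (hp : Primrec p) (hx : Primrec x) :
    Primrec fun a => output (d a) (σ a) (p a) (x a) := by
  have hi : Primrec fun a => (σ a).1 := fst.comp hσ
  have hleaf : Primrec fun a => leafProgram (d a) (σ a) :=
    list_append.comp (primrec_binaryCode (nat_add.comp hd (const 1)) hi)
      (primrec_binaryCode (nat_add.comp (nat_add.comp
        (primrec_scale hd (nat_add.comp hi (const 1))) hd) (const 1)) (fst.comp (snd.comp hσ)))
  have hu : Primrec fun z : α × Edge => false :: z.2.2.1 :=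
    list_cons.comp (const false) (fst.comp (snd.comp snd))
  have hv : Primrec fun z : α × Edge => true :: z.2.2.2 :=
    list_cons.comp (const true) (snd.comp (snd.comp snd))
  have htable : Primrec fun a => table (d a) (σ a) := by
    refine Primrec.ite (nat_le.comp hi (primrec_pow (const 2) hd)) (list_append.comp
      (list_map (primrec_edges hd hσ) ?_) (list_map (primrec_edges hd hσ) ?_)) (const [])
    · exact hu.pair ((primrec_binaryCode (primrec_scale (hd.comp fst) (hi.comp fst))
        (fst.comp snd)).pair hv)
    · exact hv.pair ((hleaf.comp fst).pair hu)
  refine option_map (list_head?.comp (primrec_filter htable ?_)) (snd.comp (snd.comp snd)).to₂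
  exact (PrimrecPred.and (Primrec.eq.comp (fst.comp snd) (hx.comp fst))
    (Primrec.eq.comp (fst.comp (snd.comp snd)) (hp.comp fst))).decide

/-- The search over the time `s` is the only unbounded operation; the game up to time `s` is
primitive recursive because the approximated answers are. -/
theorem partrec_machine
    (hans : Primrec fun z : ℕ × BitString × BitString × BitString =>
      ans z.1 z.2.1 z.2.2.1 z.2.2.2) : Partrec₂ (machine ans) := by
  refine Partrec.rfindOpt (α := BitString × BitString)
    (f := fun a s => if 2 ^ 16 ≤ a.2.length then output (depth a.2.length)
      (run ans (depth a.2.length) (a.2.length - 1) s) a.1 a.2 else none) (Primrec.to_comp ?_)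
  have hx : Primrec fun z : (BitString × BitString) × ℕ => z.1.2 := snd.comp fst
  have hd := primrec_depth (list_length.comp hx)
  exact Primrec.ite (nat_le.comp (const (2 ^ 16)) (list_length.comp hx)) (primrec_output hd
    (primrec_run hans hd (nat_sub.comp (list_length.comp hx) (const 1)) snd)
    (fst.comp fst) hx) (const none)

/-- A computable machine is the increasing union of its primitive recursive approximations. -/
theorem exists_primrec_approximation {U : Machine} (hU : Partrec₂ U) :
    ∃ f : ℕ → BitString → BitString → Option BitString,
      (Primrec fun z : ℕ × BitString × BitString => f z.1 z.2.1 z.2.2) ∧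
      (∀ p x y, y ∈ U p x ↔ ∃ s, y ∈ f s p x) ∧
      ∀ s s' p x y, s ≤ s' → y ∈ f s p x → y ∈ f s' p x := by
  obtain ⟨c, hc⟩ := Nat.Partrec.Code.exists_code.1 hU
  have key : ∀ p x, c.eval (Encodable.encode (p, x)) = (U p x).map Encodable.encode := by
    intro p x
    rw [hc]
    simp [Encodable.encodek]
  refine ⟨fun s p x => (Nat.Partrec.Code.evaln s c (Encodable.encode (p, x))).bind
    fun k => Encodable.decode k, ?_, ?_, ?_⟩
  · exact option_bind (Nat.Partrec.Code.primrec_evaln.comp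
      ((fst.pair (const c)).pair (Primrec.encode.comp snd))) (Primrec.decode.comp snd).to₂
  · intro p x y
    constructor
    · intro h
      have h' : Encodable.encode y ∈ c.eval (Encodable.encode (p, x)) := by
        rw [key]; exact Part.mem_map _ h
      obtain ⟨s, hs⟩ := Nat.Partrec.Code.evaln_complete.1 h'
      refine ⟨s, ?_⟩
      exact Option.bind_eq_some_iff.2 ⟨_, hs, Encodable.encodek y⟩
    · rintro ⟨s, hs⟩
      obtain ⟨k, hk, hy⟩ := Option.bind_eq_some_iff.1 hs
      have h' := Nat.Partrec.Code.evaln_sound hk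
      rw [key] at h'
      obtain ⟨y', hy', rfl⟩ := (Part.mem_map_iff _).1 h'
      rw [Encodable.encodek] at hy
      exact Option.some.inj hy ▸ hy'
  · intro s s' p x y h hs
    obtain ⟨k, hk, hy⟩ := Option.bind_eq_some_iff.1 hs
    exact Option.bind_eq_some_iff.2 ⟨k, Nat.Partrec.Code.evaln_mono h hk, hy⟩

end Primrec

/-! ### Scales and edges -/

/-- The gap pays for a leaf program: `d + 1` bits for the level, and `d + 1` bits by which the round
counter exceeds the next scale. -/
theorem scale_eq_add {d i : ℕ} (hi : i ≤ 2 ^ d) : scale d i = scale d (i + 1) + (2 * d + 2) := by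
  have h : 2 ^ d + 1 - i = (2 ^ d + 1 - (i + 1)) + 1 := by omega
  rw [scale, scale, h, Nat.add_mul, one_mul]

theorem scale_succ_le (d i : ℕ) : scale d (i + 1) ≤ scale d i :=
  Nat.mul_le_mul_right _ (by omega)

theorem scale_le_zero (d i : ℕ) : scale d i ≤ scale d 0 :=
  Nat.mul_le_mul_right _ (by omega)

theorem mem_edges {d : ℕ} {σ : State} {e : Edge} :
    e ∈ edges d σ ↔ ∃ q < σ.2.2.1.length, q % (2 ^ scale d σ.1 + 1) ≠ 0 ∧
      e = (q % (2 ^ scale d σ.1 + 1) - 1,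
        σ.2.2.1.getD (q - q % (2 ^ scale d σ.1 + 1)) [], σ.2.2.1.getD q []) := by
  simp only [edges, List.mem_filterMap, List.mem_range]
  refine exists_congr fun q => and_congr_right fun _ => ?_
  by_cases h : q % (2 ^ scale d σ.1 + 1) = 0
  · simp [h]
  · simp [h, eq_comm]

theorem getD_inj {l : List BitString} (hl : l.Nodup) {i j : ℕ} (hi : i < l.length)
    (hj : j < l.length) (h : l.getD i [] = l.getD j []) : i = j := by
  rw [List.getD_eq_getElem _ _ hi, List.getD_eq_getElem _ _ hj] at h
  exact hl.getElem_inj_iff.1 h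

theorem getD_mem {l : List BitString} {i : ℕ} (hi : i < l.length) : l.getD i [] ∈ l := by
  rw [List.getD_eq_getElem _ _ hi]
  exact List.getElem_mem _

theorem edge_index_lt {d : ℕ} {σ : State} {e : Edge} (he : e ∈ edges d σ) :
    e.1 < 2 ^ scale d σ.1 := by
  obtain ⟨q, -, h0, rfl⟩ := mem_edges.1 he
  have := Nat.mod_lt q (Nat.succ_pos (2 ^ scale d σ.1))
  simp only [Nat.succ_eq_add_one] at this
  dsimp only
  omega

theorem centre_mem {d : ℕ} {σ : State} {e : Edge} (he : e ∈ edges d σ) : e.2.1 ∈ σ.2.2.1 := by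
  obtain ⟨q, hq, -, rfl⟩ := mem_edges.1 he
  exact getD_mem (lt_of_le_of_lt (Nat.sub_le _ _) hq)

theorem leaf_mem {d : ℕ} {σ : State} {e : Edge} (he : e ∈ edges d σ) : e.2.2 ∈ σ.2.2.1 := by
  obtain ⟨q, hq, -, rfl⟩ := mem_edges.1 he
  exact getD_mem hq

/-- Centres sit at the multiples of the block length and leaves elsewhere. As only leaves stay in
play, a centre is never used again. -/
theorem centre_ne_leaf {d : ℕ} {σ : State} (hσ : σ.2.2.1.Nodup) {e e' : Edge}
    (he : e ∈ edges d σ) (he' : e' ∈ edges d σ) : e.2.1 ≠ e'.2.2 := by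
  obtain ⟨q, hq, -, rfl⟩ := mem_edges.1 he
  obtain ⟨q', hq', h0, rfl⟩ := mem_edges.1 he'
  intro h
  have h' := getD_inj hσ (lt_of_le_of_lt (Nat.sub_le _ _) hq) hq' h
  apply h0
  rw [← h']
  exact Nat.mod_eq_zero_of_dvd (Nat.dvd_sub_mod q)

theorem edge_eq_of_leaf {d : ℕ} {σ : State} (hσ : σ.2.2.1.Nodup) {e e' : Edge}
    (he : e ∈ edges d σ) (he' : e' ∈ edges d σ) (h : e.2.2 = e'.2.2) : e = e' := by
  obtain ⟨q, hq, -, rfl⟩ := mem_edges.1 he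
  obtain ⟨q', hq', h0, rfl⟩ := mem_edges.1 he'
  obtain rfl := getD_inj hσ hq hq' h
  rfl

theorem edge_eq_of_centre {d : ℕ} {σ : State} (hσ : σ.2.2.1.Nodup) {e e' : Edge}
    (he : e ∈ edges d σ) (he' : e' ∈ edges d σ) (h₁ : e.1 = e'.1) (h₂ : e.2.1 = e'.2.1) :
    e = e' := by
  obtain ⟨q, hq, h0, rfl⟩ := mem_edges.1 he
  obtain ⟨q', hq', h0', rfl⟩ := mem_edges.1 he'
  have h := getD_inj hσ (lt_of_le_of_lt (Nat.sub_le _ _) hq)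
    (lt_of_le_of_lt (Nat.sub_le _ _) hq') h₂
  dsimp only at h₁
  have := Nat.mod_le q (2 ^ scale d σ.1 + 1)
  have := Nat.mod_le q' (2 ^ scale d σ.1 + 1)
  obtain rfl : q = q' := by omega
  rfl

theorem nodup_edges {d : ℕ} {σ : State} (hσ : σ.2.2.1.Nodup) : (edges d σ).Nodup := by
  refine List.pairwise_filterMap.2 (List.Pairwise.imp_of_mem ?_ List.nodup_range)
  intro q q' hq hq' hne e he e' he' h
  subst h
  rw [List.mem_range] at hq hq'
  split_ifs at he with h0
  split_ifs at he' with h0'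
  rw [Option.some.injEq] at he he'
  exact hne (getD_inj hσ hq hq' (congrArg (fun e : Edge => e.2.2) (he.trans he'.symm)))

theorem nodup_leaves {d : ℕ} {σ : State} (hσ : σ.2.2.1.Nodup) :
    ((edges d σ).map fun e => e.2.2).Nodup :=
  (nodup_edges hσ).map_on fun _ he _ he' h => edge_eq_of_leaf hσ he he' h

/-! ### Replies of the opponent -/

/-- The answers of an opponent: an edge that was given a cell keeps it, and comparable cells are
given to different edges only if these edges have no common end. -/
structure IsOpponent (ans : ℕ → BitString → BitString → BitString → Bool) : Prop where
  mono : ∀ {s s' p u v}, s ≤ s' → ans s p u v = true → ans s' p u v = true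
  left : ∀ {s s' p q u v v'}, ans s p u v = true → ans s' q u v' = true → p <+: q → v = v'
  right : ∀ {s s' p q u u' v}, ans s p u v = true → ans s' q u' v = true → p <+: q → u = u'

variable {ans : ℕ → BitString → BitString → BitString → Bool}

theorem reply_eq_some {d s i : ℕ} {e : Edge} {c : BitString} (h : reply ans d s i e = some c) :
    c.length = scale d i + d ∧ ans s c (false :: e.2.1) (true :: e.2.2) = true := by
  have := List.mem_of_mem_head? (Option.mem_def.2 h)
  rw [List.mem_filter, mem_bitStrings] at this
  exact this

theorem reply_eq_none {d s i : ℕ} {e : Edge} :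
    reply ans d s i e = none ↔ ∀ c : BitString, c.length = scale d i + d →
      ¬ ans s c (false :: e.2.1) (true :: e.2.2) = true := by
  rw [reply, List.head?_eq_none_iff, List.filter_eq_nil_iff]
  simp only [mem_bitStrings]

theorem mem_survivors {d s : ℕ} {σ : State} {c w : BitString} :
    w ∈ survivors ans d s σ c ↔
      ∃ e ∈ edges d σ, reply ans d s σ.1 e = some c ∧ e.2.2 = w := by
  simp [survivors, and_assoc]

theorem nodup_survivors {d s : ℕ} {σ : State} {c : BitString} (hσ : σ.2.2.1.Nodup) :
    (survivors ans d s σ c).Nodup :=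
  ((nodup_edges hσ).filter _).map_on fun _ he _ he' h =>
    edge_eq_of_leaf hσ (List.mem_of_mem_filter he) (List.mem_of_mem_filter he') h

/-- The cells of length `k` that meet the cells of `B`. -/
def hits (k : ℕ) (B : List BitString) : Finset BitString := (B.map (List.take k)).toFinset

theorem mem_hits {k : ℕ} {B : List BitString} {c : BitString} :
    c ∈ hits k B ↔ ∃ b ∈ B, b.take k = c := by
  simp [hits]

theorem card_hits_le {k : ℕ} {B : List BitString} (hB : ∀ b ∈ B, k ≤ b.length) :
    (hits k B).card ≤ 2 ^ k := by
  have h : hits k B ⊆ (bitStrings k).toFinset := by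
    intro c hc
    obtain ⟨b, hb, rfl⟩ := mem_hits.1 hc
    rw [List.mem_toFinset, mem_bitStrings, List.length_take, min_eq_left (hB b hb)]
  calc (hits k B).card ≤ _ := Finset.card_le_card h
    _ ≤ _ := List.toFinset_card_le _
    _ = 2 ^ k := length_bitStrings k

/-- At most `2 ^ j` strings of length `k + j` have a given prefix of length `k`. -/
theorem card_le_of_take_mem {S T : Finset BitString} {k j : ℕ}
    (hS : ∀ c ∈ S, c.length = k + j) (hT : ∀ c ∈ S, c.take k ∈ T) : S.card ≤ T.card * 2 ^ j := by
  calc S.card ≤ (T ×ˢ (bitStrings j).toFinset).card := by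
        refine Finset.card_le_card_of_injOn (fun c => (c.take k, c.drop k)) ?_ ?_
        · intro c hc
          simp only [Finset.coe_product, Set.mem_prod, Finset.mem_coe, List.mem_toFinset,
            mem_bitStrings, List.length_drop]
          exact ⟨hT c hc, by rw [hS c hc]; omega⟩
        · intro c _ c' _ h
          obtain ⟨h₁, h₂⟩ := Prod.mk.inj h
          rw [← List.take_append_drop k c, h₁, h₂, List.take_append_drop]
    _ = T.card * (bitStrings j).toFinset.card := Finset.card_product _ _
    _ = T.card * 2 ^ j := by
        rw [List.toFinset_card_of_nodup (nodup_bitStrings j), length_bitStrings]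

theorem pick_eq_some {d s : ℕ} {σ : State} {c : BitString} (h : pick ans d s σ = some c) :
    c.length = scale d σ.1 + d ∧
      c.take (scale d (σ.1 + 1) + d) ∉ hits (scale d (σ.1 + 1) + d) σ.2.2.2 ∧
      σ.2.2.1.length ≤ lossFactor d * (survivors ans d s σ c).length := by
  have := List.mem_of_mem_head? (Option.mem_def.2 h)
  rw [List.mem_filter, mem_bitStrings, Bool.and_eq_true, decide_eq_true_iff, List.isEmpty_iff,
    List.filter_eq_nil_iff] at this
  refine ⟨this.1, fun hc => ?_, this.2.2⟩
  obtain ⟨b, hb, hbc⟩ := mem_hits.1 hc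
  exact this.2.1 b hb (decide_eq_true hbc.symm)

theorem pick_eq_none {d s : ℕ} {σ : State} (h : pick ans d s σ = none) {c : BitString}
    (hc : c.length = scale d σ.1 + d)
    (hnew : c.take (scale d (σ.1 + 1) + d) ∉ hits (scale d (σ.1 + 1) + d) σ.2.2.2) :
    lossFactor d * (survivors ans d s σ c).length < σ.2.2.1.length := by
  rw [pick, List.head?_eq_none_iff, List.filter_eq_nil_iff] at h
  by_contra! hlt
  refine h c (mem_bitStrings.2 hc) ?_
  rw [Bool.and_eq_true, decide_eq_true_iff, List.isEmpty_iff, List.filter_eq_nil_iff]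
  refine ⟨fun b hb hbc => hnew (mem_hits.2 ⟨b, hb, (of_decide_eq_true hbc).symm⟩), hlt⟩

/-! ### Counting in one round -/

/-- The edge to the `r`-th leaf of the `j`-th star. -/
def starEdge (d : ℕ) (σ : State) (j r : ℕ) : Edge :=
  (r, σ.2.2.1.getD (j * (2 ^ scale d σ.1 + 1)) [],
    σ.2.2.1.getD (j * (2 ^ scale d σ.1 + 1) + (r + 1)) [])

theorem star_index_lt {M N j r : ℕ} (hj : j < N / (M + 1)) (hr : r < M) :
    j * (M + 1) + (r + 1) < N := by
  have h₁ : (j + 1) * (M + 1) ≤ N :=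
    (Nat.mul_le_mul_right _ hj).trans (Nat.div_mul_le_self N (M + 1))
  rw [Nat.add_mul, one_mul] at h₁
  omega

theorem starEdge_mem {d : ℕ} {σ : State} {j r : ℕ}
    (hj : j < σ.2.2.1.length / (2 ^ scale d σ.1 + 1)) (hr : r < 2 ^ scale d σ.1) :
    starEdge d σ j r ∈ edges d σ := by
  have h : (j * (2 ^ scale d σ.1 + 1) + (r + 1)) % (2 ^ scale d σ.1 + 1) = r + 1 := by
    rw [Nat.mul_add_mod_of_lt (by omega)]
  refine mem_edges.2 ⟨_, star_index_lt hj hr, by omega, ?_⟩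
  rw [h, starEdge, Nat.add_sub_cancel, Nat.add_sub_cancel]

theorem starEdge_leaf_inj {d : ℕ} {σ : State} (hσ : σ.2.2.1.Nodup) {j j' r r' : ℕ}
    (hj : j < σ.2.2.1.length / (2 ^ scale d σ.1 + 1)) (hr : r < 2 ^ scale d σ.1)
    (hj' : j' < σ.2.2.1.length / (2 ^ scale d σ.1 + 1)) (hr' : r' < 2 ^ scale d σ.1)
    (h : (starEdge d σ j r).2.2 = (starEdge d σ j' r').2.2) : j = j' ∧ r = r' := by
  have h := getD_inj hσ (star_index_lt hj hr) (star_index_lt hj' hr') h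
  have hmod := congrArg (· % (2 ^ scale d σ.1 + 1)) h
  simp only [Nat.mul_add_mod_of_lt (show r + 1 < 2 ^ scale d σ.1 + 1 by omega),
    Nat.mul_add_mod_of_lt (show r' + 1 < 2 ^ scale d σ.1 + 1 by omega)] at hmod
  obtain rfl : r = r' := by omega
  refine ⟨?_, rfl⟩
  have : j * (2 ^ scale d σ.1 + 1) = j' * (2 ^ scale d σ.1 + 1) := by omega
  exact Nat.eq_of_mul_eq_mul_right (Nat.succ_pos _) this

/-- With at least one full block, the incomplete last block at most doubles the count. -/
theorem length_le_mul_div {M N : ℕ} (h : M + 1 ≤ N) : N ≤ 2 * (M + 1) * (N / (M + 1)) := by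
  have h₁ : 1 ≤ N / (M + 1) := (Nat.one_le_div_iff (Nat.succ_pos M)).2 h
  have h₂ := Nat.div_add_mod N (M + 1)
  have h₃ := Nat.mod_lt N (Nat.succ_pos M)
  nlinarith

/-- The loss in one round: the first factor passes from names to stars, `2 ^ (scale d i + d)` counts
the cells in the pigeonhole, and the remaining 2 makes its contradiction strict. -/
theorem two_mul_block_le {d i : ℕ} :
    2 * (2 ^ scale d i + 1) * (2 * 2 ^ (scale d i + d)) ≤ lossFactor d := by
  have h₁ : 2 * (2 ^ scale d i + 1) ≤ 2 ^ (scale d i + 2) := by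
    have := Nat.one_le_two_pow (n := scale d i)
    rw [pow_add]; omega
  calc _ ≤ 2 ^ (scale d i + 2) * (2 * 2 ^ (scale d i + d)) := Nat.mul_le_mul_right _ h₁
    _ = 2 ^ (2 * scale d i + d + 3) := by ring
    _ ≤ _ := Nat.pow_le_pow_right two_pos (by have := scale_le_zero d i; omega)

/-- One edge per full star is already enough. -/
theorem length_le_edges {d : ℕ} {σ : State} (hσ : σ.2.2.1.Nodup)
    (hN : 2 ^ scale d σ.1 + 1 ≤ σ.2.2.1.length) :
    σ.2.2.1.length ≤ lossFactor d * (edges d σ).length := by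
  have h₁ : σ.2.2.1.length / (2 ^ scale d σ.1 + 1) ≤ (edges d σ).length := by
    have hpos : 0 < 2 ^ scale d σ.1 := by positivity
    calc _ = (Finset.range (σ.2.2.1.length / (2 ^ scale d σ.1 + 1))).card :=
          (Finset.card_range _).symm
      _ ≤ (edges d σ).toFinset.card := by
          refine Finset.card_le_card_of_injOn (fun j => starEdge d σ j 0) ?_ ?_
          · intro j hj
            rw [Finset.mem_coe, Finset.mem_range] at hj
            exact List.mem_toFinset.2 (starEdge_mem hj hpos)
          · intro j hj j' hj' h
            rw [Finset.mem_coe, Finset.mem_range] at hj hj'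
            exact (starEdge_leaf_inj hσ hj hpos hj' hpos
              (congrArg (fun e : Edge => e.2.2) h)).1
      _ ≤ _ := List.toFinset_card_le _
  have h₂ : 2 * (2 ^ scale d σ.1 + 1) ≤ lossFactor d :=
    le_trans (Nat.le_mul_of_pos_right _ (by positivity)) (two_mul_block_le (i := σ.1))
  exact (length_le_mul_div hN).trans (Nat.mul_le_mul h₂ h₁)

/-- If no cell can be picked, then some star is given old cells only. -/
theorem exists_star_of_pick_eq_none {d s : ℕ} {σ : State} (hσ : σ.2.2.1.Nodup)
    (hN : 2 ^ scale d σ.1 + 1 ≤ σ.2.2.1.length)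
    (h : pick ans d s σ = none) :
    ∃ j < σ.2.2.1.length / (2 ^ scale d σ.1 + 1), ∀ r < 2 ^ scale d σ.1,
      ∀ c, reply ans d s σ.1 (starEdge d σ j r) = some c →
        c.take (scale d (σ.1 + 1) + d) ∈ hits (scale d (σ.1 + 1) + d) σ.2.2.2 := by
  classical
  by_contra! hcon
  choose! r hr c hc hnew using hcon
  set n := σ.2.2.1.length / (2 ^ scale d σ.1 + 1) with hn
  set cells := (bitStrings (scale d σ.1 + d)).toFinset.filter fun c =>
    c.take (scale d (σ.1 + 1) + d) ∉ hits (scale d (σ.1 + 1) + d) σ.2.2.2 with hcells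
  have hcard : cells.card ≤ 2 ^ (scale d σ.1 + d) :=
    (Finset.card_filter_le _ _).trans
      ((List.toFinset_card_le _).trans (length_bitStrings _).le)
  -- In the contrary case each star has a leaf served by a new cell; these leaves are distinct and
  -- survive for their cells.
  have hle : n ≤ ∑ c ∈ cells, (survivors ans d s σ c).length := by
    calc n = (Finset.range n).card := (Finset.card_range _).symm
      _ ≤ (cells.biUnion fun c => (survivors ans d s σ c).toFinset).card := by
          refine Finset.card_le_card_of_injOn (fun j => (starEdge d σ j (r j)).2.2) ?_ ?_
          · intro j hj
            rw [Finset.mem_coe, Finset.mem_range] at hj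
            rw [Finset.mem_coe, Finset.mem_biUnion]
            refine ⟨c j, Finset.mem_filter.2 ⟨?_, hnew j hj⟩, List.mem_toFinset.2 ?_⟩
            · exact List.mem_toFinset.2 (mem_bitStrings.2 (reply_eq_some (hc j hj)).1)
            · exact mem_survivors.2 ⟨_, starEdge_mem hj (hr j hj), hc j hj, rfl⟩
          · intro j hj j' hj' h
            rw [Finset.mem_coe, Finset.mem_range] at hj hj'
            exact (starEdge_leaf_inj hσ hj (hr j hj) hj' (hr j' hj') h).1
      _ ≤ ∑ c ∈ cells, (survivors ans d s σ c).toFinset.card := Finset.card_biUnion_le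
      _ ≤ _ := Finset.sum_le_sum fun c _ => List.toFinset_card_le _
  have hsum : lossFactor d * n ≤ 2 ^ (scale d σ.1 + d) * σ.2.2.1.length := by
    calc lossFactor d * n ≤ ∑ c ∈ cells, lossFactor d * (survivors ans d s σ c).length := by
          rw [← Finset.mul_sum]; exact Nat.mul_le_mul_left _ hle
      _ ≤ ∑ c ∈ cells, σ.2.2.1.length := by
          refine Finset.sum_le_sum fun c hc => (pick_eq_none h ?_ (Finset.mem_filter.1 hc).2).le
          exact mem_bitStrings.1 (List.mem_toFinset.1 (Finset.mem_filter.1 hc).1)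
      _ ≤ _ := by
          rw [Finset.sum_const, smul_eq_mul]
          exact Nat.mul_le_mul_right _ hcard
  have h₁ := length_le_mul_div hN
  have h₂ := two_mul_block_le (d := d) (i := σ.1)
  have h₃ : 0 < 2 ^ (scale d σ.1 + d) := by positivity
  rw [← hn] at h₁
  have h₄ : 2 * 2 ^ (scale d σ.1 + d) * σ.2.2.1.length
      ≤ 2 ^ (scale d σ.1 + d) * σ.2.2.1.length :=
    calc 2 * 2 ^ (scale d σ.1 + d) * σ.2.2.1.length
        ≤ 2 * 2 ^ (scale d σ.1 + d) * (2 * (2 ^ scale d σ.1 + 1) * n) :=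
          Nat.mul_le_mul_left _ h₁
      _ = 2 * (2 ^ scale d σ.1 + 1) * (2 * 2 ^ (scale d σ.1 + d)) * n := by ring
      _ ≤ lossFactor d * n := Nat.mul_le_mul_right _ h₂
      _ ≤ _ := hsum
  -- Positivity turns `h₄`, a number bounding its own double, into a contradiction.
  have h₅ : 0 < 2 ^ (scale d σ.1 + d) * σ.2.2.1.length := by
    have := lt_of_lt_of_le (Nat.succ_pos _) hN
    positivity
  rw [mul_assoc] at h₄
  omega

/-! ### Invariants of the game -/

/-- A bound for the number of successful rounds at one level, plus one. -/
def roundBound (d : ℕ) : ℕ := 2 ^ (scale d 0 + d) + 1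

/-- A number that grows with each round. -/
def progress (d : ℕ) (σ : State) : ℕ := σ.1 * roundBound d + σ.2.1

/-- The properties of the states of the game with names of length `m`. -/
structure Invariant (ans : ℕ → BitString → BitString → BitString → Bool) (d m : ℕ) (σ : State) :
    Prop where
  nodup : σ.2.2.1.Nodup
  names : ∀ w ∈ σ.2.2.1, w.length = m
  lens : ∀ b ∈ σ.2.2.2, scale d σ.1 + d ≤ b.length
  -- Since the old centre `a` is out of play, no current edge at `w` can receive a cell comparable
  -- with `b`.
  used : ∀ w ∈ σ.2.2.1, ∀ b ∈ σ.2.2.2, ∃ s, ∃ a ∉ σ.2.2.1, ans s b (false :: a) (true :: w) = true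
  level_le : σ.1 ≤ 2 ^ d
  level_hits : σ.1 * 2 ^ scale d σ.1 ≤ (hits (scale d σ.1 + d) σ.2.2.2).card
  count_le : σ.2.1 ≤ (hits (scale d (σ.1 + 1) + d) σ.2.2.2).card
  size : 2 ^ m ≤ σ.2.2.1.length * lossFactor d ^ progress d σ

namespace Invariant

variable {d m s : ℕ} {σ : State}

theorem count_le_pow (h : Invariant ans d m σ) : σ.2.1 ≤ 2 ^ (scale d (σ.1 + 1) + d) :=
  h.count_le.trans (card_hits_le fun b hb =>
    (Nat.add_le_add_right (scale_succ_le d σ.1) d).trans (h.lens b hb))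

theorem count_lt (h : Invariant ans d m σ) : σ.2.1 < roundBound d :=
  Nat.lt_succ_of_le (h.count_le_pow.trans
    (Nat.pow_le_pow_right two_pos (Nat.add_le_add_right (scale_le_zero d _) d)))

/-- The counter stays below `roundBound d`, so `progress` orders the pairs of level and counter
lexicographically. -/
theorem progress_lt (h : Invariant ans d m σ) : progress d σ < (2 ^ d + 1) * roundBound d := by
  have h₁ := h.count_lt
  have h₂ : σ.1 * roundBound d ≤ 2 ^ d * roundBound d := Nat.mul_le_mul_right _ h.level_le
  rw [progress, Nat.add_mul, one_mul]
  omega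

/-- The initial supply allows one loss factor per unit of progress up to the maximum, and still
leaves a full star of the largest size, that of level 0. -/
theorem block_le (h : Invariant ans d m σ)
    (hm : (2 ^ scale d 0 + 1) * lossFactor d ^ ((2 ^ d + 1) * roundBound d) ≤ 2 ^ m) :
    2 ^ scale d σ.1 + 1 ≤ σ.2.2.1.length := by
  have hQ : 0 < lossFactor d := by unfold lossFactor; positivity
  have h₁ : (2 ^ scale d 0 + 1) * lossFactor d ^ ((2 ^ d + 1) * roundBound d)
      ≤ σ.2.2.1.length * lossFactor d ^ ((2 ^ d + 1) * roundBound d) :=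
    hm.trans (h.size.trans (Nat.mul_le_mul_left _ (Nat.pow_le_pow_right hQ h.progress_lt.le)))
  have h₂ := Nat.le_of_mul_le_mul_right h₁ (Nat.pow_pos hQ)
  have h₃ : 2 ^ scale d σ.1 ≤ 2 ^ scale d 0 := Nat.pow_le_pow_right two_pos (scale_le_zero d _)
  omega

theorem of_pick_eq_some (h : Invariant ans d m σ) {c : BitString} (hc : pick ans d s σ = some c) :
    Invariant ans d m (σ.1, σ.2.1 + 1, survivors ans d s σ c, c :: σ.2.2.2) where
  nodup := nodup_survivors h.nodup
  names w hw := by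
    obtain ⟨e, he, -, rfl⟩ := mem_survivors.1 hw
    exact h.names _ (leaf_mem he)
  lens b hb := by
    rcases List.mem_cons.1 hb with rfl | hb
    · exact (pick_eq_some hc).1.ge
    · exact h.lens b hb
  used w hw b hb := by
    obtain ⟨e, he, hr, rfl⟩ := mem_survivors.1 hw
    rcases List.mem_cons.1 hb with rfl | hb
    -- The picked cell was used with the centre of this round, which is not among the survivors.
    · refine ⟨s, e.2.1, fun hmem => ?_, (reply_eq_some hr).2⟩
      obtain ⟨e', he', -, heq⟩ := mem_survivors.1 hmem
      exact centre_ne_leaf h.nodup he he' heq.symm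
    · obtain ⟨s', a, ha, hans⟩ := h.used _ (leaf_mem he) b hb
      refine ⟨s', a, fun hmem => ha ?_, hans⟩
      obtain ⟨e', he', -, rfl⟩ := mem_survivors.1 hmem
      exact leaf_mem he'
  level_le := h.level_le
  level_hits := h.level_hits.trans (Finset.card_le_card fun x hx => by
    obtain ⟨b, hb, rfl⟩ := mem_hits.1 hx
    exact mem_hits.2 ⟨b, List.mem_cons_of_mem _ hb, rfl⟩)
  count_le := by
    have hnew := (pick_eq_some hc).2.1
    have heq : hits (scale d (σ.1 + 1) + d) (c :: σ.2.2.2) =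
        insert (c.take (scale d (σ.1 + 1) + d)) (hits (scale d (σ.1 + 1) + d) σ.2.2.2) := by
      simp [hits]
    dsimp only
    rw [heq, Finset.card_insert_of_notMem hnew]
    exact Nat.succ_le_succ h.count_le
  size := by
    refine h.size.trans ?_
    have hp : progress d (σ.1, σ.2.1 + 1, survivors ans d s σ c, c :: σ.2.2.2) =
        progress d σ + 1 := rfl
    rw [hp, pow_succ', ← mul_assoc, mul_comm _ (lossFactor d)]
    exact Nat.mul_le_mul_right _ (pick_eq_some hc).2.2

/-- If no cell can be picked, then the opponent has used one more unit at the next scale. -/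
theorem succ_mul_le_hits (h : Invariant ans d m σ) (hans : IsOpponent ans)
    (hblock : 2 ^ scale d σ.1 + 1 ≤ σ.2.2.1.length)
    (hreply : ∀ e ∈ edges d σ, reply ans d s σ.1 e ≠ none) (hpick : pick ans d s σ = none) :
    (σ.1 + 1) * 2 ^ scale d (σ.1 + 1) ≤ (hits (scale d (σ.1 + 1) + d) σ.2.2.2).card := by
  classical
  obtain ⟨j, hj, hstar⟩ := exists_star_of_pick_eq_none h.nodup hblock hpick
  have hmem : ∀ r < 2 ^ scale d σ.1, starEdge d σ j r ∈ edges d σ :=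
    fun r hr => starEdge_mem hj hr
  have hex : ∀ r < 2 ^ scale d σ.1, ∃ c, reply ans d s σ.1 (starEdge d σ j r) = some c :=
    fun r hr => Option.ne_none_iff_exists'.1 (hreply _ (hmem r hr))
  choose! c hc using hex
  set C := (Finset.range (2 ^ scale d σ.1)).image c with hC
  -- The edges of a star share their centre, so equal cells force equal leaves.
  have hCcard : C.card = 2 ^ scale d σ.1 := by
    rw [hC, Finset.card_image_of_injOn, Finset.card_range]
    intro r hr r' hr' heq
    rw [Finset.mem_coe, Finset.mem_range] at hr hr'
    have h₁ := (reply_eq_some (hc r hr)).2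
    have h₂ := (reply_eq_some (hc r' hr')).2
    have h₃ := hans.left h₁ h₂ (by rw [heq])
    exact (starEdge_leaf_inj h.nodup hj hr hj hr' (List.cons.inj h₃).2).2
  -- A cell of the star that is a prefix of an old cell `b` would serve two edges at one leaf. The
  -- two centres would then coincide, but the old one is out of play.
  have hdisj : Disjoint (hits (scale d σ.1 + d) σ.2.2.2) C := by
    rw [Finset.disjoint_left]
    intro x hx hxC
    obtain ⟨b, hb, rfl⟩ := mem_hits.1 hx
    obtain ⟨r, hr, hrb⟩ := Finset.mem_image.1 hxC
    rw [Finset.mem_range] at hr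
    obtain ⟨s', a, ha, hab⟩ := h.used _ (leaf_mem (hmem r hr)) b hb
    have h₁ := hans.right (reply_eq_some (hc r hr)).2 hab (by rw [hrb]; exact List.take_prefix _ _)
    exact ha ((List.cons.inj h₁).2 ▸ centre_mem (hmem r hr))
  have hk : scale d σ.1 = scale d (σ.1 + 1) + (2 * d + 2) := scale_eq_add h.level_le
  -- Old cells and cells of the star all lie in coarse cells hit by old ones, and each coarse cell
  -- contains `2 ^ (2 * d + 2)` fine ones.
  have hbound : (hits (scale d σ.1 + d) σ.2.2.2 ∪ C).card ≤
      (hits (scale d (σ.1 + 1) + d) σ.2.2.2).card * 2 ^ (2 * d + 2) := by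
    refine card_le_of_take_mem (k := scale d (σ.1 + 1) + d) ?_ ?_
    · intro x hx
      have hx' : x.length = scale d σ.1 + d := by
        rcases Finset.mem_union.1 hx with hx | hx
        · obtain ⟨b, hb, rfl⟩ := mem_hits.1 hx
          rw [List.length_take, min_eq_left (h.lens b hb)]
        · obtain ⟨r, hr, rfl⟩ := Finset.mem_image.1 hx
          exact (reply_eq_some (hc r (Finset.mem_range.1 hr))).1
      omega
    · intro x hx
      rcases Finset.mem_union.1 hx with hx | hx
      · obtain ⟨b, hb, rfl⟩ := mem_hits.1 hx
        rw [List.take_take, min_eq_left (by omega)]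
        exact mem_hits.2 ⟨b, hb, rfl⟩
      · obtain ⟨r, hr, rfl⟩ := Finset.mem_image.1 hx
        rw [Finset.mem_range] at hr
        exact hstar r hr _ (hc r hr)
  rw [Finset.card_union_of_disjoint hdisj, hCcard] at hbound
  have h₁ := h.level_hits
  refine Nat.le_of_mul_le_mul_right ?_ (Nat.two_pow_pos (2 * d + 2))
  calc (σ.1 + 1) * 2 ^ scale d (σ.1 + 1) * 2 ^ (2 * d + 2)
      = σ.1 * 2 ^ scale d σ.1 + 2 ^ scale d σ.1 := by rw [hk, pow_add]; ring
    _ ≤ _ := (Nat.add_le_add_right h₁ _).trans hbound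

theorem of_pick_eq_none (h : Invariant ans d m σ) (hans : IsOpponent ans)
    (hblock : 2 ^ scale d σ.1 + 1 ≤ σ.2.2.1.length)
    (hreply : ∀ e ∈ edges d σ, reply ans d s σ.1 e ≠ none) (hpick : pick ans d s σ = none) :
    Invariant ans d m (σ.1 + 1, 0, (edges d σ).map (fun e => e.2.2), σ.2.2.2) := by
  have hhits := h.succ_mul_le_hits hans hblock hreply hpick
  have hlens : ∀ b ∈ σ.2.2.2, scale d (σ.1 + 1) + d ≤ b.length := fun b hb =>
    (Nat.add_le_add_right (scale_succ_le d σ.1) d).trans (h.lens b hb)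
  have hsub : ∀ w ∈ (edges d σ).map (fun e => e.2.2), w ∈ σ.2.2.1 := by
    intro w hw
    obtain ⟨e, he, rfl⟩ := List.mem_map.1 hw
    exact leaf_mem he
  refine ⟨nodup_leaves h.nodup, fun w hw => h.names w (hsub w hw), hlens, ?_, ?_, hhits,
    Nat.zero_le _, ?_⟩
  · intro w hw b hb
    obtain ⟨s', a, ha, hab⟩ := h.used w (hsub w hw) b hb
    exact ⟨s', a, fun hmem => ha (hsub a hmem), hab⟩
  -- Only `2 ^ (scale d (σ.1 + 1) + d)` coarse cells exist; dividing by `2 ^ scale d (σ.1 + 1)`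
  -- bounds the new level.
  · have h₁ := hhits.trans (card_hits_le hlens)
    rw [pow_add, mul_comm (2 ^ scale d (σ.1 + 1))] at h₁
    exact Nat.le_of_mul_le_mul_right h₁ (by positivity)
  · have hQ : 0 < lossFactor d := by unfold lossFactor; positivity
    have hp : progress d σ + 1 ≤
        progress d (σ.1 + 1, 0, (edges d σ).map (fun e => e.2.2), σ.2.2.2) := by
      have := h.count_lt
      simp only [progress, Nat.add_mul, one_mul]
      omega
    calc 2 ^ m ≤ σ.2.2.1.length * lossFactor d ^ progress d σ := h.size
      _ ≤ lossFactor d * (edges d σ).length * lossFactor d ^ progress d σ :=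
          Nat.mul_le_mul_right _ (length_le_edges h.nodup hblock)
      _ = (edges d σ).length * lossFactor d ^ (progress d σ + 1) := by ring
      _ ≤ _ := by
          dsimp only
          rw [List.length_map]
          exact Nat.mul_le_mul_left _ (Nat.pow_le_pow_right hQ hp)

theorem advance (h : Invariant ans d m σ) (hans : IsOpponent ans)
    (hblock : 2 ^ scale d σ.1 + 1 ≤ σ.2.2.1.length)
    (hreply : ∀ e ∈ edges d σ, reply ans d s σ.1 e ≠ none) :
    Invariant ans d m (advance ans d s σ) := by
  unfold InfoDistGame.advance
  cases hp : pick ans d s σ with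
  | none => exact h.of_pick_eq_none hans hblock hreply hp
  | some c => exact h.of_pick_eq_some hp

end Invariant

theorem progress_lt_advance {d m s : ℕ} {σ : State} (h : Invariant ans d m σ) :
    progress d σ < progress d (advance ans d s σ) := by
  unfold advance
  cases hp : pick ans d s σ with
  | none =>
    have := h.count_lt
    simp only [progress, Nat.add_mul, one_mul]
    omega
  | some c => simp only [progress]; omega

theorem mem_advance {d s : ℕ} {σ : State} {w : BitString} (hw : w ∈ (advance ans d s σ).2.2.1) :
    ∃ e ∈ edges d σ, e.2.2 = w := by
  unfold advance at hw
  cases hp : pick ans d s σ with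
  | none => rw [hp] at hw; exact List.mem_map.1 hw
  | some c =>
    rw [hp] at hw
    obtain ⟨e, he, -, rfl⟩ := mem_survivors.1 hw
    exact ⟨e, he, rfl⟩

theorem step_eq_advance {d s : ℕ} {σ : State} (hi : σ.1 ≤ 2 ^ d)
    (h : ∀ e ∈ edges d σ, reply ans d s σ.1 e ≠ none) : step ans d s σ = advance ans d s σ := by
  refine if_pos ⟨hi, ?_⟩
  rw [List.isEmpty_iff, List.filter_eq_nil_iff]
  intro e he
  rw [Option.isNone_iff_eq_none]
  exact h e he

theorem step_eq_self_or {d s : ℕ} {σ : State} : step ans d s σ = σ ∨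
    (∀ e ∈ edges d σ, reply ans d s σ.1 e ≠ none) ∧ step ans d s σ = advance ans d s σ := by
  by_cases h : ∀ e ∈ edges d σ, reply ans d s σ.1 e ≠ none
  · rw [step]
    split_ifs
    · exact Or.inr ⟨h, rfl⟩
    · exact Or.inl rfl
  · refine Or.inl ?_
    rw [step, if_neg]
    rintro ⟨-, hall⟩
    rw [List.isEmpty_iff, List.filter_eq_nil_iff] at hall
    refine h fun e he hnone => hall e he ?_
    rw [hnone]; rfl

/-! ### The run of the game with a sufficient supply of names -/

section Run

variable {d m : ℕ} (hans : IsOpponent ans)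
  (hm : (2 ^ scale d 0 + 1) * lossFactor d ^ ((2 ^ d + 1) * roundBound d) ≤ 2 ^ m)

include hans hm

theorem invariant_run (s : ℕ) : Invariant ans d m (run ans d m s) := by
  induction s with
  | zero =>
    refine ⟨nodup_bitStrings m, fun w hw => mem_bitStrings.1 hw, ?_, ?_, ?_, ?_, ?_, ?_⟩
    · intro b hb; cases hb
    · intro _ _ b hb; cases hb
    · exact Nat.zero_le _
    · simp [run]
    · exact Nat.zero_le _
    · simp [run, progress, length_bitStrings]
  | succ s ih =>
    rcases step_eq_self_or (ans := ans) (d := d) (s := s) (σ := run ans d m s) with h | ⟨hr, h⟩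
    · exact (show run ans d m (s + 1) = _ from h) ▸ ih
    · exact (show run ans d m (s + 1) = _ from h) ▸ ih.advance hans (ih.block_le hm) hr

/-- Every change of state raises the progress and keeps only leaves, so states never recur and old
centres never return. -/
theorem run_eq_or_of_le {s s' : ℕ} (hs : s ≤ s') : run ans d m s' = run ans d m s ∨
    progress d (run ans d m s) < progress d (run ans d m s') ∧
      ∀ w ∈ (run ans d m s').2.2.1, ∃ e ∈ edges d (run ans d m s), e.2.2 = w := by
  induction s', hs using Nat.le_induction with
  | base => exact Or.inl rfl
  | succ s' hs ih =>
    rcases step_eq_self_or (ans := ans) (d := d) (s := s') (σ := run ans d m s') with h | ⟨-, h⟩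
    · rw [show run ans d m (s' + 1) = run ans d m s' from h]
      exact ih
    · rw [show run ans d m (s' + 1) = _ from h]
      have hlt := progress_lt_advance (s := s') (invariant_run hans hm s')
      right
      rcases ih with ih | ⟨ih, hsub⟩
      · rw [ih] at hlt ⊢
        exact ⟨hlt, fun w hw => mem_advance hw⟩
      · refine ⟨ih.trans hlt, fun w hw => ?_⟩
        obtain ⟨e, he, rfl⟩ := mem_advance hw
        exact hsub _ (leaf_mem he)

/-- Some requested edge never gets a cell. -/
theorem exists_edge_without_reply : ∃ s, ∃ e ∈ edges d (run ans d m s),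
    ∀ s', reply ans d s' (run ans d m s).1 e = none := by
  by_contra! hcon
  have key : ∀ N, ∃ s, N ≤ progress d (run ans d m s) := by
    intro N
    induction N with
    | zero => exact ⟨0, Nat.zero_le _⟩
    | succ N ih =>
      obtain ⟨s, hs⟩ := ih
      choose! time htime using hcon s
      -- By time `s'` all requests of the state at time `s` are served. Either the state has already
      -- changed, or it changes in the next step.
      set s' := max s ((edges d (run ans d m s)).toFinset.sup time) with hs'
      have hr : ∀ e ∈ edges d (run ans d m s), reply ans d s' (run ans d m s).1 e ≠ none := by
        intro e he hnone
        obtain ⟨c, hc⟩ := Option.ne_none_iff_exists'.1 (htime e he)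
        obtain ⟨hlen, hc⟩ := reply_eq_some hc
        refine reply_eq_none.1 hnone c hlen (hans.mono ?_ hc)
        exact (Finset.le_sup (f := time) (List.mem_toFinset.2 he)).trans (le_max_right _ _)
      rcases run_eq_or_of_le hans hm (le_max_left s _ : s ≤ s') with h | ⟨h, -⟩
      · refine ⟨s' + 1, ?_⟩
        have hadv : run ans d m (s' + 1) = advance ans d s' (run ans d m s) := by
          rw [← h] at hr ⊢
          exact step_eq_advance (invariant_run hans hm s').level_le hr
        rw [hadv]
        exact hs.trans_lt (progress_lt_advance (invariant_run hans hm s))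
      · exact ⟨s', hs.trans_lt h⟩
  obtain ⟨s, hs⟩ := key ((2 ^ d + 1) * roundBound d)
  exact absurd (invariant_run hans hm s).progress_lt (not_lt.2 hs)

/-! ### The programs of the game -/

/-- A centre leaves play as soon as the state changes, so all its edges belong to one state. -/
theorem eq_of_centre_eq {s s' : ℕ} {e e' : Edge} (he : e ∈ edges d (run ans d m s))
    (he' : e' ∈ edges d (run ans d m s')) (h : e.2.1 = e'.2.1) :
    run ans d m s = run ans d m s' := by
  wlog hs : s ≤ s' generalizing s s' e e'
  · exact (this he' he h.symm (le_of_not_ge hs)).symm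
  rcases run_eq_or_of_le hans hm hs with heq | ⟨-, hsub⟩
  · exact heq.symm
  · obtain ⟨e₀, he₀, h₀⟩ := hsub _ (centre_mem he')
    exact absurd (h.trans h₀.symm) (centre_ne_leaf (invariant_run hans hm s).nodup he he₀)

theorem eq_of_level_eq {s s' : ℕ} (h₁ : (run ans d m s).1 = (run ans d m s').1)
    (h₂ : (run ans d m s).2.1 = (run ans d m s').2.1) : run ans d m s = run ans d m s' := by
  have hp : progress d (run ans d m s) = progress d (run ans d m s') := by
    rw [progress, progress, h₁, h₂]
  rcases le_total s s' with hs | hs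
  · exact (run_eq_or_of_le hans hm hs).elim Eq.symm fun h => absurd hp h.1.ne
  · exact (run_eq_or_of_le hans hm hs).elim id fun h => absurd hp h.1.ne'

theorem level_lt (s : ℕ) : (run ans d m s).1 < 2 ^ (d + 1) := by
  have := (invariant_run hans hm s).level_le
  have := Nat.one_le_two_pow (n := d)
  rw [pow_succ]
  omega

/-- The bound by the number of coarse cells may be attained, hence one extra bit in the counter. -/
theorem count_lt_pow (s : ℕ) :
    (run ans d m s).2.1 < 2 ^ (scale d ((run ans d m s).1 + 1) + d + 1) :=
  (invariant_run hans hm s).count_le_pow.trans_lt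
    (Nat.pow_lt_pow_right one_lt_two (Nat.lt_succ_self _))

theorem length_leafProgram (s : ℕ) :
    (leafProgram d (run ans d m s)).length = scale d (run ans d m s).1 := by
  rw [leafProgram, List.length_append, length_binaryCode (level_lt hans hm s),
    length_binaryCode (count_lt_pow hans hm s), scale_eq_add (invariant_run hans hm s).level_le]
  omega

omit hans hm in
theorem length_centreProgram {σ : State} {e : Edge} (he : e ∈ edges d σ) :
    (centreProgram d σ e).length = scale d σ.1 :=
  length_binaryCode (edge_index_lt he)

theorem mem_table {s : ℕ} {z : BitString × BitString × BitString} :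
    z ∈ table d (run ans d m s) ↔ ∃ e ∈ edges d (run ans d m s),
      z = (false :: e.2.1, centreProgram d (run ans d m s) e, true :: e.2.2) ∨
      z = (true :: e.2.2, leafProgram d (run ans d m s), false :: e.2.1) := by
  rw [table, if_pos (invariant_run hans hm s).level_le, List.mem_append, List.mem_map,
    List.mem_map]
  constructor
  · rintro (⟨e, he, rfl⟩ | ⟨e, he, rfl⟩)
    exacts [⟨e, he, Or.inl rfl⟩, ⟨e, he, Or.inr rfl⟩]
  · rintro ⟨e, he, rfl | rfl⟩
    exacts [Or.inl ⟨e, he, rfl⟩, Or.inr ⟨e, he, rfl⟩]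

/-- This gives both single-valuedness and prefix-freeness. The first bit of the input separates
centres from leaves. All programs at a centre come from one state, so they have equal length and
differ in the leaf index. At a leaf, the fixed-length level code determines the length of the
program, and level and counter determine the state, hence the edge. -/
theorem table_unique {s s' : ℕ} {z z' : BitString × BitString × BitString}
    (hz : z ∈ table d (run ans d m s)) (hz' : z' ∈ table d (run ans d m s')) (h₁ : z.1 = z'.1)
    (h₂ : z.2.1 <+: z'.2.1) : z = z' := by
  obtain ⟨e, he, rfl | rfl⟩ := (mem_table hans hm).1 hz <;>
    obtain ⟨e', he', rfl | rfl⟩ := (mem_table hans hm).1 hz'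
  · have hc : e.2.1 = e'.2.1 := (List.cons.inj h₁).2
    have hs := eq_of_centre_eq hans hm he he' hc
    rw [← hs] at he' h₂ ⊢
    have hp : centreProgram d (run ans d m s) e = centreProgram d (run ans d m s) e' :=
      h₂.eq_of_length ((length_centreProgram he).trans (length_centreProgram he').symm)
    have hi := binaryCode_inj (edge_index_lt he) (edge_index_lt he') hp
    rw [edge_eq_of_centre (invariant_run hans hm s).nodup he he' hi hc]
  · exact absurd (List.cons.inj h₁).1 (by simp)
  · exact absurd (List.cons.inj h₁).1 (by simp)
  · have hi : (run ans d m s).1 = (run ans d m s').1 := by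
      have h := List.prefix_of_prefix_length_le ((List.prefix_append _ _).trans h₂)
        (List.prefix_append (binaryCode (d + 1) (run ans d m s').1) _)
        ((length_binaryCode (level_lt hans hm s)).trans
          (length_binaryCode (level_lt hans hm s')).symm).le
      exact binaryCode_inj (level_lt hans hm s) (level_lt hans hm s')
        (h.eq_of_length ((length_binaryCode (level_lt hans hm s)).trans
          (length_binaryCode (level_lt hans hm s')).symm))
    have hp : leafProgram d (run ans d m s) = leafProgram d (run ans d m s') :=
      h₂.eq_of_length (by rw [length_leafProgram hans hm, length_leafProgram hans hm, hi])
    have ht : (run ans d m s).2.1 = (run ans d m s').2.1 := by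
      have h := count_lt_pow hans hm s
      rw [leafProgram, leafProgram, hi, List.append_cancel_left_eq] at hp
      rw [hi] at h
      exact binaryCode_inj h (count_lt_pow hans hm s') hp
    have hs := eq_of_level_eq hans hm hi ht
    rw [← hs] at he' ⊢
    rw [edge_eq_of_leaf (invariant_run hans hm s).nodup he he' (List.cons.inj h₁).2]

end Run

/-! ### The machine given by the game -/

/-! ### The supply of names suffices for the chosen depth -/

theorem four_mul_add_seven_le (d : ℕ) : 4 * d + 7 ≤ 12 * 4 ^ d := by
  induction d with
  | zero => norm_num
  | succ d ih => rw [pow_succ]; omega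

/-- With `L = scale d 0 ≤ 4 * 4 ^ d`, the binary logarithm of the left side is at most `L + 1 + 2 ^
(L + 4 * d + 6)`, and `L + 4 * d + 7 ≤ 16 * 4 ^ d = 2 ^ (2 * d + 4)`, which is at most `log log n`
exponentiated once. The bound `2 ^ 16` makes the subtraction in `depth` exact. -/
theorem enough_names {n : ℕ} (hn : 2 ^ 16 ≤ n) :
    (2 ^ scale (depth n) 0 + 1) *
      lossFactor (depth n) ^ ((2 ^ depth n + 1) * roundBound (depth n)) ≤ 2 ^ (n - 1) := by
  have hn0 : n ≠ 0 := by rintro rfl; norm_num at hn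
  have hlog : 2 ^ 4 ≤ Nat.log 2 n := Nat.le_log_of_pow_le one_lt_two (by norm_num at hn ⊢; exact hn)
  have hloglog : 4 ≤ Nat.log 2 (Nat.log 2 n) := Nat.le_log_of_pow_le one_lt_two hlog
  have hd : 2 * depth n + 4 ≤ Nat.log 2 (Nat.log 2 n) := by unfold depth; omega
  have hbig : 2 ^ 2 ^ (2 * depth n + 4) ≤ n :=
    (Nat.pow_le_pow_right two_pos ((Nat.pow_le_pow_right two_pos hd).trans
      (Nat.pow_log_le_self 2 (by omega)))).trans (Nat.pow_log_le_self 2 hn0)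
  generalize depth n = d at hbig ⊢
  have hscale : scale d 0 ≤ 4 * 4 ^ d := by
    have h₁ : d + 1 ≤ 2 ^ d := Nat.lt_two_pow_self
    have h₂ : (4 : ℕ) ^ d = 2 ^ d * 2 ^ d := by rw [← mul_pow]; norm_num
    have h₃ := Nat.one_le_two_pow (n := d)
    rw [scale, h₂, Nat.sub_zero]
    calc (2 ^ d + 1) * (2 * d + 2) ≤ (2 ^ d + 2 ^ d) * (2 * 2 ^ d) :=
          Nat.mul_le_mul (by omega) (by omega)
      _ = _ := by ring
  set L := scale d 0 with hL
  have h₄ := four_mul_add_seven_le d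
  have h₅ : 2 * L + d + 3 ≤ 2 ^ (2 * d + 4) := by
    have : (2 : ℕ) ^ (2 * d + 4) = 16 * 4 ^ d := by rw [pow_add, pow_mul]; norm_num [mul_comm]
    omega
  have h₆ : 2 ^ d + 1 ≤ 2 ^ (d + 1) := by
    have := Nat.one_le_two_pow (n := d)
    rw [pow_succ]; omega
  have h₇ : roundBound d ≤ 2 ^ (L + d + 1) := by
    have := Nat.one_le_two_pow (n := L + d)
    rw [roundBound, ← hL, pow_succ 2 (L + d)]; omega
  have h₈ : 2 ^ L + 1 ≤ 2 ^ (L + 1) := by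
    have := Nat.one_le_two_pow (n := L)
    rw [pow_succ]; omega
  have h₉ : (2 * L + d + 3) * ((2 ^ d + 1) * roundBound d) ≤ 2 ^ (L + 4 * d + 6) :=
    calc _ ≤ 2 ^ (2 * d + 4) * (2 ^ (d + 1) * 2 ^ (L + d + 1)) :=
          Nat.mul_le_mul h₅ (Nat.mul_le_mul h₆ h₇)
      _ = _ := by ring
  have h₁₀ : L + 2 ≤ 2 ^ (L + 4 * d + 6) := by
    have := Nat.lt_two_pow_self (n := L + 4 * d + 6)
    omega
  have h₁₁ : 2 ^ (L + 4 * d + 7) ≤ n := by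
    refine le_trans (Nat.pow_le_pow_right two_pos ?_) hbig
    have : (2 : ℕ) ^ (2 * d + 4) = 16 * 4 ^ d := by rw [pow_add, pow_mul]; norm_num [mul_comm]
    omega
  have h₁₂ : (2 : ℕ) ^ (L + 4 * d + 7) = 2 * 2 ^ (L + 4 * d + 6) := by ring
  calc (2 ^ L + 1) * lossFactor d ^ ((2 ^ d + 1) * roundBound d)
      ≤ 2 ^ (L + 1) * 2 ^ ((2 * L + d + 3) * ((2 ^ d + 1) * roundBound d)) := by
        rw [lossFactor, ← hL, ← pow_mul]
        exact Nat.mul_le_mul_right _ h₈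
    _ = 2 ^ (L + 1 + (2 * L + d + 3) * ((2 ^ d + 1) * roundBound d)) := (pow_add _ _ _).symm
    _ ≤ 2 ^ (n - 1) := Nat.pow_le_pow_right two_pos (by omega)

theorem mem_table_of_output {d : ℕ} {σ : State} {p x y : BitString} (h : y ∈ output d σ p x) :
    (x, p, y) ∈ table d σ := by
  obtain ⟨z, hz, rfl⟩ := Option.map_eq_some_iff.1 h
  have := List.mem_of_mem_head? (Option.mem_def.2 hz)
  rw [List.mem_filter, decide_eq_true_iff] at this
  obtain ⟨hmem, rfl, rfl⟩ := this
  exact hmem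

theorem exists_output {d : ℕ} {σ : State} {p x y : BitString} (h : (x, p, y) ∈ table d σ) :
    ∃ y', y' ∈ output d σ p x := by
  have hmem : (x, p, y) ∈ (table d σ).filter fun z => decide (z.1 = x ∧ z.2.1 = p) :=
    List.mem_filter.2 ⟨h, by simp⟩
  cases hf : (table d σ).filter fun z => decide (z.1 = x ∧ z.2.1 = p) with
  | nil => rw [hf] at hmem; cases hmem
  | cons z l => exact ⟨z.2.2, by rw [output, hf]; rfl⟩

theorem mem_table_of_mem_machine {p x y : BitString} (h : y ∈ machine ans p x) :
    2 ^ 16 ≤ x.length ∧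
      ∃ s, (x, p, y) ∈ table (depth x.length) (run ans (depth x.length) (x.length - 1) s) := by
  obtain ⟨s, hs⟩ := Nat.rfindOpt_spec h
  split_ifs at hs with hx
  · exact ⟨hx, s, mem_table_of_output hs⟩
  · cases hs

theorem mem_machine_of_mem_table (hans : IsOpponent ans) {p x y : BitString} {s : ℕ}
    (hx : 2 ^ 16 ≤ x.length)
    (h : (x, p, y) ∈ table (depth x.length) (run ans (depth x.length) (x.length - 1) s)) :
    y ∈ machine ans p x := by
  obtain ⟨y', hy'⟩ := exists_output h
  have hdom : (machine ans p x).Dom := by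
    refine Nat.rfindOpt_dom.2 ⟨s, y', ?_⟩
    rw [if_pos hx]
    exact hy'
  obtain ⟨-, s', hs'⟩ := mem_table_of_mem_machine (Part.get_mem hdom)
  -- The search may stop at another time than `s`, but the output is the same.
  have := table_unique hans (enough_names hx) h hs' rfl (List.prefix_refl p)
  rw [(Prod.mk.inj (Prod.mk.inj this).2).2]
  exact Part.get_mem hdom

theorem isPrefixFree_machine (hans : IsOpponent ans) : IsPrefixFree (machine ans) := by
  intro x p q hpq hp hq
  obtain ⟨hx, s, hs⟩ := mem_table_of_mem_machine (Part.get_mem hp)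
  obtain ⟨-, s', hs'⟩ := mem_table_of_mem_machine (Part.get_mem hq)
  exact (Prod.mk.inj (Prod.mk.inj (table_unique hans (enough_names hx) hs hs' rfl hpq)).2).1

/-! ### Consequences for complexities and distances -/

theorem condComplexity_le {U : Machine} {p x y : BitString} (h : y ∈ U p x) :
    condComplexity U y x ≤ p.length :=
  iInf₂_le p h

theorem bipartiteInfoDist_le {U U' : Machine} {p x y : BitString} (h : y ∈ U p x)
    (h' : x ∈ U' p y) : bipartiteInfoDist U U' x y ≤ p.length :=
  iInf₂_le p ⟨h, h'⟩

/-- For a pair of prefix-stable machines, the game gives pairs of strings whose distance exceeds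
the conditional complexities. -/
theorem exists_large_bipartiteInfoDist {K S₁ S₂ : Machine}
    (hK : IsOptimalPrefixComplexityMachine K) (hS₁ : IsPrefixStableMachine S₁)
    (hS₂ : IsPrefixStableMachine S₂) :
    ∃ C : ℕ, ∀ n, 2 ^ 16 ≤ n → ∃ x y : BitString, x.length = n ∧ y.length = n ∧ ∃ k : ℕ,
      maxCondComplexity K x y ≤ ((k + C : ℕ) : ℕ∞) ∧
      ((k + depth n : ℕ) : ℕ∞) ≤ bipartiteInfoDist S₁ S₂ x y := by
  obtain ⟨f₁, hf₁, hU₁, hmono₁⟩ := exists_primrec_approximation hS₁.1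
  obtain ⟨f₂, hf₂, hU₂, hmono₂⟩ := exists_primrec_approximation hS₂.1
  set ans : ℕ → BitString → BitString → BitString → Bool := fun s p u v =>
    decide (f₁ s p u = some v ∧ f₂ s p v = some u) with hdef
  have hprim : Primrec fun z : ℕ × BitString × BitString × BitString =>
      ans z.1 z.2.1 z.2.2.1 z.2.2.2 := by
    have hs : Primrec fun z : ℕ × BitString × BitString × BitString => z.1 := .fst
    have hp : Primrec fun z : ℕ × BitString × BitString × BitString => z.2.1 :=
      Primrec.fst.comp .snd
    have hu : Primrec fun z : ℕ × BitString × BitString × BitString => z.2.2.1 :=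
      Primrec.fst.comp (Primrec.snd.comp .snd)
    have hv : Primrec fun z : ℕ × BitString × BitString × BitString => z.2.2.2 :=
      Primrec.snd.comp (Primrec.snd.comp .snd)
    exact (PrimrecPred.and
      (Primrec.eq.comp (hf₁.comp (hs.pair (hp.pair hu))) (Primrec.option_some.comp hv))
      (Primrec.eq.comp (hf₂.comp (hs.pair (hp.pair hv))) (Primrec.option_some.comp hu))).decide
  have hsound : ∀ {s p u v}, ans s p u v = true → v ∈ S₁ p u ∧ u ∈ S₂ p v := fun h =>
    have h := of_decide_eq_true h
    ⟨(hU₁ _ _ _).2 ⟨_, h.1⟩, (hU₂ _ _ _).2 ⟨_, h.2⟩⟩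
  have hcomplete : ∀ {p u v}, v ∈ S₁ p u → u ∈ S₂ p v → ∃ s, ans s p u v = true := by
    intro p u v h₁ h₂
    obtain ⟨s₁, h₁⟩ := (hU₁ _ _ _).1 h₁
    obtain ⟨s₂, h₂⟩ := (hU₂ _ _ _).1 h₂
    exact ⟨max s₁ s₂, decide_eq_true ⟨hmono₁ _ _ _ _ _ (le_max_left _ _) h₁,
      hmono₂ _ _ _ _ _ (le_max_right _ _) h₂⟩⟩
  -- Prefix-stability carries the value at `p` over to its extension `q`, where the machine is
  -- single-valued.
  have hans : IsOpponent ans :=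
    { mono := fun hs h =>
        have h := of_decide_eq_true h
        decide_eq_true ⟨hmono₁ _ _ _ _ _ hs h.1, hmono₂ _ _ _ _ _ hs h.2⟩
      left := fun h h' hpq =>
        Part.mem_unique (hS₁.2 _ _ _ _ hpq (hsound h).1) (hsound h').1
      right := fun h h' hpq =>
        Part.mem_unique (hS₂.2 _ _ _ _ hpq (hsound h).2) (hsound h').2 }
  -- One machine plays the games for all lengths, so `C` does not depend on `n`.
  obtain ⟨C, hC⟩ := hK.2 (machine ans) ⟨partrec_machine hprim, isPrefixFree_machine hans⟩
  refine ⟨C, fun n hn => ?_⟩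
  have hm := enough_names hn
  have hn0 : 1 ≤ n := le_trans (by norm_num) hn
  obtain ⟨s, e, he, hnone⟩ := exists_edge_without_reply hans hm
  set σ := run ans (depth n) (n - 1) s with hσ
  have hinv := invariant_run hans hm s
  have hlen : ∀ {w : BitString}, w ∈ σ.2.2.1 → w.length + 1 = n := fun hw => by
    rw [hinv.names _ hw]; omega
  have hu : (false :: e.2.1).length = n := hlen (centre_mem he)
  have hv : (true :: e.2.2).length = n := hlen (leaf_mem he)
  refine ⟨false :: e.2.1, true :: e.2.2, hu, hv, scale (depth n) σ.1, ?_, ?_⟩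
  · rw [Nat.cast_add]
    refine max_le ((hC _ _).trans (add_le_add_left ?_ _)) ((hC _ _).trans (add_le_add_left ?_ _))
    · rw [← length_leafProgram hans hm s]
      refine condComplexity_le (mem_machine_of_mem_table hans (s := s) (hn.trans hv.ge) ?_)
      rw [hv]
      exact (mem_table hans hm).2 ⟨e, he, Or.inr rfl⟩
    · rw [← length_centreProgram he]
      refine condComplexity_le (mem_machine_of_mem_table hans (s := s) (hn.trans hu.ge) ?_)
      rw [hu]
      exact (mem_table hans hm).2 ⟨e, he, Or.inl rfl⟩
  · refine le_iInf₂ fun p hp => Nat.cast_le.2 ?_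
    by_contra! hlt
    -- By prefix-stability a shorter common program can be padded to a cell of the exact length,
    -- contradicting that the edge is never served.
    set q : BitString := p ++ List.replicate (scale (depth n) σ.1 + depth n - p.length) false
    have hpq : p <+: q := List.prefix_append _ _
    obtain ⟨s', hs'⟩ := hcomplete (hS₁.2 _ _ _ _ hpq hp.1) (hS₂.2 _ _ _ _ hpq hp.2)
    refine reply_eq_none.1 (hnone s') q ?_ hs'
    rw [List.length_append, List.length_replicate]
    omega

/-- Every prefix-free machine has a prefix-stable extension. -/
theorem exists_prefixStable_extension {U : Machine} (hU : IsPrefixFreeMachine U) :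
    ∃ V : Machine, IsPrefixStableMachine V ∧ ∀ p x y, y ∈ U p x → y ∈ V p x := by
  obtain ⟨f, hf, hfU, -⟩ := exists_primrec_approximation hU.1
  set g : BitString → BitString → ℕ → Option BitString := fun q x s =>
    ((List.range (q.length + 1)).filterMap fun j => f s (q.take j) x).head? with hg
  have hsound : ∀ {q x s y}, y ∈ g q x s → ∃ p, p <+: q ∧ y ∈ U p x := by
    intro q x s y h
    obtain ⟨j, -, hj⟩ := List.mem_filterMap.1 (List.mem_of_mem_head? h)
    exact ⟨_, List.take_prefix j q, (hfU _ _ _).2 ⟨s, hj⟩⟩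
  have hmem : ∀ q x y, y ∈ Nat.rfindOpt (g q x) ↔ ∃ p, p <+: q ∧ y ∈ U p x := by
    intro q x y
    refine ⟨fun h => (Nat.rfindOpt_spec h).elim fun s hs => hsound hs, ?_⟩
    rintro ⟨p, hpq, hy⟩
    obtain ⟨s, hs⟩ := (hfU _ _ _).1 hy
    have hdom : (Nat.rfindOpt (g q x)).Dom := by
      have hl : y ∈ (List.range (q.length + 1)).filterMap fun j => f s (q.take j) x := by
        refine List.mem_filterMap.2 ⟨p.length, List.mem_range.2 ?_, ?_⟩
        · exact Nat.lt_succ_of_le hpq.length_le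
        · rw [← List.prefix_iff_eq_take.1 hpq]
          exact hs
      cases hl' : (List.range (q.length + 1)).filterMap fun j => f s (q.take j) x with
      | nil => rw [hl'] at hl; cases hl
      | cons a l => exact Nat.rfindOpt_dom.2 ⟨s, a, by simp only [hg]; rw [hl']; rfl⟩
    obtain ⟨s', hs'⟩ := Nat.rfindOpt_spec (Part.get_mem hdom)
    obtain ⟨p', hp'q, hy'⟩ := hsound hs'
    -- Two prefixes of `q` are comparable, so prefix-freeness leaves only one on which `U` is
    -- defined; the search cannot find a different value.
    obtain rfl : p = p' := by
      rcases List.prefix_or_prefix_of_prefix hpq hp'q with h | h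
      · exact hU.2 x p p' h (Part.dom_iff_mem.2 ⟨_, hy⟩) (Part.dom_iff_mem.2 ⟨_, hy'⟩)
      · exact (hU.2 x p' p h (Part.dom_iff_mem.2 ⟨_, hy'⟩) (Part.dom_iff_mem.2 ⟨_, hy⟩)).symm
    rw [Part.mem_unique hy hy']
    exact Part.get_mem hdom
  refine ⟨fun q x => Nat.rfindOpt (g q x), ⟨?_, ?_⟩, fun p x y h =>
    (hmem p x y).2 ⟨p, List.prefix_refl p, h⟩⟩
  · refine Partrec.rfindOpt (α := BitString × BitString) (f := fun a s => g a.1 a.2 s)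
      (Primrec.to_comp ?_)
    have hq : Primrec fun z : (BitString × BitString) × ℕ => z.1.1 := Primrec.fst.comp .fst
    have hx : Primrec fun z : (BitString × BitString) × ℕ => z.1.2 := Primrec.snd.comp .fst
    refine Primrec.list_head?.comp (Primrec.listFilterMap
      (Primrec.list_range.comp (Primrec.succ.comp (Primrec.list_length.comp hq))) ?_)
    exact hf.comp ((Primrec.snd.comp .fst).pair
      ((Primrec.list_take.comp .snd (hq.comp .fst)).pair (hx.comp .fst)))
  · intro x p q y hpq h
    obtain ⟨p', hp', hy⟩ := (hmem p x y).1 h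
    exact (hmem q x y).2 ⟨p', hp'.trans hpq, hy⟩

theorem bipartiteInfoDist_mono {U U' V V' : Machine} (h : ∀ p x y, y ∈ U p x → y ∈ V p x)
    (h' : ∀ p x y, y ∈ U' p x → y ∈ V' p x) (x y : BitString) :
    bipartiteInfoDist V V' x y ≤ bipartiteInfoDist U U' x y :=
  le_iInf₂ fun p hp => bipartiteInfoDist_le (h p x y hp.1) (h' p y x hp.2)

/-- The optimal prefix-stable bipartite distance is minimal also among prefix-free pairs. -/
theorem exists_bipartiteInfoDist_le {S₁ S₂ U U' : Machine}
    (hS : IsOptimalBipartiteInfoDistPair IsPrefixStableMachine S₁ S₂)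
    (hU : IsPrefixFreeMachine U) (hU' : IsPrefixFreeMachine U') :
    ∃ C : ℕ, ∀ x y, bipartiteInfoDist S₁ S₂ x y ≤ bipartiteInfoDist U U' x y + C := by
  obtain ⟨V, hV, hUV⟩ := exists_prefixStable_extension hU
  obtain ⟨V', hV', hUV'⟩ := exists_prefixStable_extension hU'
  obtain ⟨C, hC⟩ := hS.2.2 V V' hV hV'
  exact ⟨C, fun x y => (hC x y).trans
    (add_le_add_left (bipartiteInfoDist_mono hUV hUV' x y) _)⟩

/-! ### Real and integer iterated logarithms -/

theorem logb_logb_le {n : ℕ} (hn : 2 ≤ n) :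
    Real.logb 2 (Real.logb 2 n) ≤ Nat.log 2 (Nat.log 2 n) + 2 := by
  have hlog : ∀ k : ℕ, 1 ≤ k → Real.logb 2 k ≤ Nat.log 2 k + 1 := by
    intro k hk
    have hk' : (0 : ℝ) < k := by exact_mod_cast hk
    rw [Real.logb_le_iff_le_rpow one_lt_two hk']
    exact_mod_cast (Nat.lt_pow_succ_log_self one_lt_two k).le
  have hl : 1 ≤ Nat.log 2 n := Nat.le_log_of_pow_le one_lt_two (by simpa using hn)
  have hn' : (1 : ℝ) < n := by exact_mod_cast hn
  have hl' : (1 : ℝ) ≤ Nat.log 2 n := by exact_mod_cast hl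
  calc Real.logb 2 (Real.logb 2 n) ≤ Real.logb 2 (2 * Nat.log 2 n) :=
        Real.logb_le_logb_of_le one_lt_two (Real.logb_pos one_lt_two hn')
          ((hlog n (by omega)).trans (by linarith))
    _ = 1 + Real.logb 2 (Nat.log 2 n) := by
        rw [Real.logb_mul two_ne_zero (by positivity), Real.logb_self_eq_one one_lt_two]
    _ ≤ _ := by linarith [hlog _ hl]

theorem logb_logb_nonneg {n : ℕ} (hn : 2 ≤ n) : 0 ≤ Real.logb 2 (Real.logb 2 n) := by
  have hn' : (2 : ℝ) ≤ n := by exact_mod_cast hn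
  refine Real.logb_nonneg one_lt_two ?_
  rw [Real.le_logb_iff_rpow_le one_lt_two (by linarith), Real.rpow_one]
  exact hn'

/-- For the integer iterated logarithm `l`, the left side is at most `(l + 2) / 4` and `depth n` is
at least `(l - 5) / 2`; the claim then amounts to `l ≥ 4 * C + 12`. -/
theorem quarter_logb_logb_le {n C : ℕ} (hn : 2 ^ 2 ^ (4 * C + 12) ≤ n) :
    1 / 4 * Real.logb 2 (Real.logb 2 n) ≤ depth n - C := by
  have h₁ : 4 * C + 12 ≤ Nat.log 2 (Nat.log 2 n) :=
    Nat.le_log_of_pow_le one_lt_two (Nat.le_log_of_pow_le one_lt_two hn)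
  have h₂ : 2 ≤ n := le_trans (by
    calc 2 = 2 ^ 1 := rfl
      _ ≤ 2 ^ 2 ^ (4 * C + 12) := Nat.pow_le_pow_right two_pos Nat.one_le_two_pow) hn
  have h₃ : Nat.log 2 (Nat.log 2 n) ≤ 2 * depth n + 5 := by unfold depth; omega
  have h₄ := logb_logb_le h₂
  have h₁' : (4 * C + 12 : ℝ) ≤ Nat.log 2 (Nat.log 2 n) := by exact_mod_cast h₁
  have h₃' : (Nat.log 2 (Nat.log 2 n) : ℝ) ≤ 2 * depth n + 5 := by exact_mod_cast h₃
  linarith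

theorem exceedsBy_of_add_le {a b : ℕ∞} {k m C : ℕ} {r : ℝ} (hb : b ≤ (k : ℕ∞))
    (h : ((k + m : ℕ) : ℕ∞) ≤ a + (C : ℕ∞)) (hr₀ : 0 ≤ r)
    (hr : r ≤ m - C) : ExceedsBy a b r := by
  unfold ExceedsBy
  induction a using ENat.recTopCoe with
  | top => simp
  | coe a =>
    have h' : k + m ≤ a + C := by exact_mod_cast h
    have hm : (k : ℝ) + m ≤ a + C := by exact_mod_cast h'
    have hk : (k : ℝ≥0∞) = ENNReal.ofReal k := (ENNReal.ofReal_natCast k).symm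
    calc (b : ℝ≥0∞) + ENNReal.ofReal r ≤ (k : ℝ≥0∞) + ENNReal.ofReal (a - k) := by
          gcongr
          · exact_mod_cast ENat.toENNReal_le.2 hb
          · linarith
      _ ≤ (a : ℝ≥0∞) := by
          rw [hk, ← ENNReal.ofReal_add (Nat.cast_nonneg k) (by linarith), add_sub_cancel,
            ENNReal.ofReal_natCast]

end InfoDistGame

theorem theorem2 :
    ∃ c : ℝ, 0 < c ∧
      ∀ K F S F₁ F₂ S₁ S₂ : Machine,
        IsOptimalPrefixComplexityMachine K →
        IsOptimalInfoDistMachine IsPrefixFreeMachine F →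
        IsOptimalInfoDistMachine IsPrefixStableMachine S →
        IsOptimalBipartiteInfoDistPair IsPrefixFreeMachine F₁ F₂ →
        IsOptimalBipartiteInfoDistPair IsPrefixStableMachine S₁ S₂ →
        ∃ n₀ : ℕ, ∀ n : ℕ, n₀ ≤ n →
          ∃ x y : BitString, x.length = n ∧ y.length = n ∧
            maxCondComplexity K x y ≠ ⊤ ∧
            ExceedsBy (infoDist F x y) (maxCondComplexity K x y)
              (c * Real.logb 2 (Real.logb 2 (n : ℝ))) ∧
            ExceedsBy (infoDist S x y) (maxCondComplexity K x y)
              (c * Real.logb 2 (Real.logb 2 (n : ℝ))) ∧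
            ExceedsBy (bipartiteInfoDist F₁ F₂ x y) (maxCondComplexity K x y)
              (c * Real.logb 2 (Real.logb 2 (n : ℝ))) ∧
            ExceedsBy (bipartiteInfoDist S₁ S₂ x y) (maxCondComplexity K x y)
              (c * Real.logb 2 (Real.logb 2 (n : ℝ))) := by
  open InfoDistGame in
  refine ⟨1 / 4, by norm_num, fun K F S F₁ F₂ S₁ S₂ hK hF hS hF₁₂ hS₁₂ => ?_⟩
  obtain ⟨C, hC⟩ := exists_large_bipartiteInfoDist hK hS₁₂.1 hS₁₂.2.1
  -- `infoDist F` unfolds to `bipartiteInfoDist F F`, so each distance is compared with the optimal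
  -- bipartite prefix-stable one, and one pair of strings serves all four.
  obtain ⟨C₁, hC₁⟩ := exists_bipartiteInfoDist_le hS₁₂ hF.1 hF.1
  obtain ⟨C₂, hC₂⟩ := hS₁₂.2.2 S S hS.1 hS.1
  obtain ⟨C₃, hC₃⟩ := exists_bipartiteInfoDist_le hS₁₂ hF₁₂.1 hF₁₂.2.1
  set C' := C + C₁ + C₂ + C₃ with hC'
  refine ⟨2 ^ 2 ^ (4 * C' + 12), fun n hn => ?_⟩
  have hn16 : 2 ^ 16 ≤ n := by
    refine le_trans (Nat.pow_le_pow_right two_pos ?_) hn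
    calc 16 = 2 ^ 4 := by norm_num
      _ ≤ 2 ^ (4 * C' + 12) := Nat.pow_le_pow_right two_pos (by omega)
  have hr := quarter_logb_logb_le hn
  obtain ⟨x, y, hx, hy, k, hk, hdist⟩ := hC n hn16
  have key : ∀ (a : ℕ∞) (D : ℕ), C + D ≤ C' → bipartiteInfoDist S₁ S₂ x y ≤ a + D →
      ExceedsBy a (maxCondComplexity K x y) (1 / 4 * Real.logb 2 (Real.logb 2 (n : ℝ))) := by
    intro a D hD ha
    refine exceedsBy_of_add_le (m := depth n) (C := C') hk ?_
      (mul_nonneg (by norm_num) (logb_logb_nonneg (le_trans (by norm_num) hn16))) hr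
    calc ((k + C + depth n : ℕ) : ℕ∞) = ((k + depth n : ℕ) : ℕ∞) + C := by push_cast; ring
      _ ≤ a + D + C := add_le_add_left (hdist.trans ha) _
      _ = a + ((C + D : ℕ) : ℕ∞) := by push_cast; ring
      _ ≤ a + C' := add_le_add_right (Nat.cast_le.2 hD) _
  refine ⟨x, y, hx, hy, ne_top_of_le_ne_top (ENat.natCast_ne_top _) hk,
    key _ C₁ (by omega) (hC₁ x y), key _ C₂ (by omega) (hC₂ x y),
    key _ C₃ (by omega) (hC₃ x y), key _ 0 (by omega) ?_⟩
  simp
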